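/- Let $n\ge 2$. For a complex Borel measure $\mu$ on $\mathbb{R}^n$ (so $\mu$ has finite total variation) put $\widehat\mu(\xi)=\int e^{-i x\cdot\xi}\,d\mu(x)$. For $\sigma>0$ let $\mathcal{K}_\sigma$ be the class of such $\mu$ with $\int d\mu=1$ for which there are constants $A,B>0$ with $$A\min\{1,|\xi|^{2\sigma}\}\le|1-\widehat\mu(\xi)|\le B\min\{1,|\xi|^{2\sigma}\}\qquad\text{for all }\xi\in\mathbb{R}^n .$$ For $t>0$ let $M_\mu^tf(x)=\int f(x-ty)\,d\mu(y)$. For $f\in L^p(\mathbb{R}^n)$ let $\widehat f$ be its Fourier transform as a tempered distribution, normalized so that $\widehat f(\xi)=\int e^{-ix\cdot\xi}f(x)\,dx$ for $f\in L^1$. Write $r'=r/(r-1)$. Theorem. Let $\sigma>0$ and $\mu\in\mathcal{K}_\sigma$. (1) Let $1<p\le 2$ and $p\le q\le p'$. There is a constant $c_{p,q}>0$, independent of $f$ and $t$, such that for every $f\in L^p(\mathbb{R}^n)$ the transform $\widehat f$ is a function, $|\xi|^{n(1-\frac1p-\frac1q)}\widehat f(\xi)\in L^q(\mathbb{R}^n)$,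 and for all $t>0$ $$\left[\int_{\mathbb{R}^n}\min\{1,(t|\xi|)^{2\sigma q}\}\,|\xi|^{qn(1-\frac1p-\frac1q)}\,|\widehat f(\xi)|^q\,d\xi\right]^{1/q}\le c_{p,q}\,\|M_\mu^tf-f\|_p .$$ (2) Let $2\le p<\infty$, $q>1$ and $\max\{q,q'\}\le p$. There is a constant $c_{p,q}>0$, independent of $f$ and $t$, such that for every $f\in L^p(\mathbb{R}^n)$ whose transform $\widehat f$ is a function with $|\xi|^{n(1-\frac1p-\frac1q)}\widehat f(\xi)\in L^q(\mathbb{R}^n)$, and for all $t>0$, $$\|M_\mu^tf-f\|_p\le c_{p,q}\left[\int_{\mathbb{R}^n}\min\{1,(t|\xi|)^{2\sigma q}\}\,|\xi|^{qn(1-\frac1p-\frac1q)}\,|\widehat f(\xi)|^q\,d\xi\right]^{1/q}.$$ -/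

import Mathlib

open MeasureTheory
open scoped SchwartzMap ENNReal

noncomputable section

/-- The kernel `e^{-i x·ξ}` of the Fourier transform. -/
def fourierKernel {n : ℕ} (x ξ : EuclideanSpace ℝ (Fin n)) : ℂ :=
  Complex.exp (-(Complex.I * ((inner ℝ x ξ : ℝ) : ℂ)))

/-- The Fourier transform `μ̂(ξ) = ∫ e^{-i x·ξ} dμ(x)` of a finite complex Borel measure. -/
def measureFourier {n : ℕ} (μ : ComplexMeasure (EuclideanSpace ℝ (Fin n)))
    (ξ : EuclideanSpace ℝ (Fin n)) : ℂ :=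
  ∫ᵛ x, fourierKernel x ξ ∂[ContinuousLinearMap.mul ℝ ℂ; μ]

/-- The class `K_σ` (`σ > 0`): finite Borel measures with total integral `1` for which
`|1 - μ̂(ξ)|` is comparable to `min {1, |ξ|^{2σ}}`, uniformly in `ξ`. -/
structure InClassK {n : ℕ} (σ : ℝ) (μ : ComplexMeasure (EuclideanSpace ℝ (Fin n))) : Prop where
  sigma_pos : 0 < σ
  total_eq_one : μ Set.univ = 1
  comparable : ∃ A B : ℝ, 0 < A ∧ 0 < B ∧ ∀ ξ : EuclideanSpace ℝ (Fin n),
    A * min 1 (‖ξ‖ ^ (2 * σ)) ≤ ‖1 - measureFourier μ ξ‖ ∧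
      ‖1 - measureFourier μ ξ‖ ≤ B * min 1 (‖ξ‖ ^ (2 * σ))

/-- The averaging operator `M_μ^t f (x) = ∫ f(x - t y) dμ(y)`. -/
def averageOp {n : ℕ} (μ : ComplexMeasure (EuclideanSpace ℝ (Fin n))) (t : ℝ)
    (f : EuclideanSpace ℝ (Fin n) → ℂ) (x : EuclideanSpace ℝ (Fin n)) : ℂ :=
  ∫ᵛ y, f (x - t • y) ∂[ContinuousLinearMap.mul ℝ ℂ; μ]

/-- The Fourier transform `φ̂(x) = ∫ e^{-i x·ξ} φ(ξ) dξ` of a Schwartz function. -/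
def schwartzFourier {n : ℕ} (φ : 𝓢(EuclideanSpace ℝ (Fin n), ℂ))
    (x : EuclideanSpace ℝ (Fin n)) : ℂ :=
  ∫ ξ, fourierKernel x ξ * φ ξ

/-- The Fourier transform of `f` (an element of some `L^p`, regarded as a tempered distribution)
is the function `g`: for all Schwartz functions `φ`, `∫ g φ = ∫ f φ̂`. -/
structure IsFourierTransform {n : ℕ} (f g : EuclideanSpace ℝ (Fin n) → ℂ) : Prop where
  aestronglyMeasurable : AEStronglyMeasurable g volume
  integrable_mul : ∀ φ : 𝓢(EuclideanSpace ℝ (Fin n), ℂ), Integrable (fun ξ => g ξ * φ ξ) volume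
  pairing_eq : ∀ φ : 𝓢(EuclideanSpace ℝ (Fin n), ℂ),
    ∫ ξ, g ξ * φ ξ = ∫ x, f x * schwartzFourier φ x

/-- The weighted transform `|ξ|^{n(1 - 1/p - 1/q)} g(ξ)`. -/
def weighted {n : ℕ} (p q : ℝ) (g : EuclideanSpace ℝ (Fin n) → ℂ)
    (ξ : EuclideanSpace ℝ (Fin n)) : ℂ :=
  ((‖ξ‖ ^ ((n : ℝ) * (1 - 1 / p - 1 / q)) : ℝ) : ℂ) * g ξ

/-- The quantity
`[∫ min {1, (t|ξ|)^{2σq}} |ξ|^{qn(1 - 1/p - 1/q)} |g(ξ)|^q dξ]^{1/q}`, valued in `[0, ∞]`. -/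
def weightedFourierNorm {n : ℕ} (σ p q t : ℝ) (g : EuclideanSpace ℝ (Fin n) → ℂ) : ℝ≥0∞ :=
  (∫⁻ ξ : EuclideanSpace ℝ (Fin n),
    ENNReal.ofReal (min 1 ((t * ‖ξ‖) ^ (2 * σ * q)) *
      ‖ξ‖ ^ (q * (n : ℝ) * (1 - 1 / p - 1 / q)) * ‖g ξ‖ ^ q)) ^ (1 / q)

end

/-! On the Fourier side `f ↦ M_μ^t f - f` is multiplication by `μ̂(tξ) - 1`, and membership in `K_σ`
makes the modulus of this factor comparable to `min {1, (t|ξ|)^{2σ}}`, uniformly in `t`. So (1) is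
Pitt's inequality `‖ |ξ|^{n(1-1/p-1/q)} ĝ ‖_q ≤ C ‖g‖_p` for `g = M_μ^t f - f`
(`exists_eLpNorm_weighted_le`), and (2) is its dual (`exists_eLpNorm_le_weighted`). Only the
absolute value of the multiplier matters, because both inequalities see `ĝ` through a weighted `L^q`
norm.

For `p = 2` Pitt's inequality is Plancherel. For `1 < p < 2`, Hölder's inequality interpolates
between the endpoints `q = p` (Hardy–Littlewood–Paley) and `q = p'` (Hausdorff–Young). Both
endpoints come from Paley's inequality `∫ |f̂|^p φ^{2-p} ≤ C M^{2-p} ∫ |f|^p`, valid when `|{φ > s}|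
≤ M/s` for all `s > 0`: take `φ = |ξ|^{-n}` for the first and a truncation of `φ = |f̂|^{p'}` for
the second. Paley's inequality is Marcinkiewicz interpolation for `f ↦ f̂/φ` with respect to `φ²
dξ`, between the `L^1 → L^∞` bound and Plancherel.

The dual form tests `M_μ^t f - f` against Schwartz functions, each of which is itself a Fourier
transform, and applies Pitt's inequality with the exponents `p'`, `q'`. -/

open scoped FourierTransform NNReal

/-! ### Polar decomposition of complex measures. -/

namespace MeasureTheory.ComplexMeasure

variable {X : Type*} [MeasurableSpace X] (μ : ComplexMeasure X)

/-- A complex measure has finite total variation. -/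
theorem isFiniteMeasure_variation : IsFiniteMeasure μ.variation := by
  refine isFiniteMeasure_of_le ((re μ).totalVariation + (im μ).totalVariation) ?_
  refine VectorMeasure.variation_le_of_forall_enorm_le fun s hs => ?_
  have h1 : μ s = ((re μ s : ℝ) : ℂ) + ((im μ s : ℝ) : ℂ) * Complex.I :=
    (Complex.re_add_im (μ s)).symm
  rw [h1, Measure.add_apply]
  refine (enorm_add_le _ _).trans (add_le_add ?_ ?_)
  · refine le_trans (le_of_eq ?_) (SignedMeasure.enorm_le_totalVariation _ _)
    rw [← ofReal_norm, ← ofReal_norm, Complex.norm_real]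
  · refine le_trans (le_of_eq ?_) (SignedMeasure.enorm_le_totalVariation _ _)
    rw [← ofReal_norm, ← ofReal_norm, norm_mul, Complex.norm_real, Complex.norm_I, mul_one]

theorem withDensity_rnDeriv_eq_of_absolutelyContinuous (ρ : Measure X) [SigmaFinite ρ]
    (hμ : ∀ s, MeasurableSet s → ρ s = 0 → μ s = 0) : ρ.withDensityᵥ (μ.rnDeriv ρ) = μ := by
  have key : ∀ ν : SignedMeasure X, (∀ s, MeasurableSet s → ρ s = 0 → ν s = 0) →
      ρ.withDensityᵥ (ν.rnDeriv ρ) = ν := fun ν hν =>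
    SignedMeasure.withDensityᵥ_rnDeriv_eq ν ρ (VectorMeasure.AbsolutelyContinuous.mk
      fun s hs h0 => hν s hs (by rwa [Measure.toENNRealVectorMeasure_apply_measurable hs] at h0))
  have hre := key (re μ) fun s hs h0 => by
    change (μ s).re = 0
    rw [hμ s hs h0, Complex.zero_re]
  have him := key (im μ) fun s hs h0 => by
    change (μ s).im = 0
    rw [hμ s hs h0, Complex.zero_im]
  ext i hi : 1
  rw [withDensityᵥ_apply (integrable_rnDeriv μ ρ) hi]
  apply Complex.ext
  · rw [← RCLike.re_eq_complex_re, ← integral_re (integrable_rnDeriv μ ρ).integrableOn]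
    have h := congrArg (fun ν : SignedMeasure X => ν i) hre
    simp only [withDensityᵥ_apply (SignedMeasure.integrable_rnDeriv (re μ) ρ) hi] at h
    exact h
  · rw [← RCLike.im_eq_complex_im, ← integral_im (integrable_rnDeriv μ ρ).integrableOn]
    have h := congrArg (fun ν : SignedMeasure X => ν i) him
    simp only [withDensityᵥ_apply (SignedMeasure.integrable_rnDeriv (im μ) ρ) hi] at h
    exact h

/-- Polar decomposition of a complex measure, in terms of integrals. -/
theorem exists_unimodular_density : ∃ h : X → ℂ, Measurable h ∧ (∀ x, ‖h x‖ = 1) ∧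
    ∀ f : X → ℂ, ∫ᵛ x, f x ∂[ContinuousLinearMap.mul ℝ ℂ; μ] = ∫ x, f x * h x ∂μ.variation := by
  have := isFiniteMeasure_variation μ
  have hd : Integrable (μ.rnDeriv μ.variation) μ.variation := integrable_rnDeriv _ _
  have heq : μ.variation.withDensityᵥ (μ.rnDeriv μ.variation) = μ := by
    refine withDensity_rnDeriv_eq_of_absolutelyContinuous _ _ fun s hs h0 => ?_
    have := VectorMeasure.enorm_measure_le_variation μ s
    rw [h0] at this
    simpa using this
  -- The variation of `d · |μ|` is `|d| · |μ|`. Here `d · |μ|` is `μ`, so `|d| = 1` almost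
  -- everywhere.
  have hone : ∀ᵐ x ∂μ.variation, ‖μ.rnDeriv μ.variation x‖ = 1 := by
    have h1 := Measure.variation_withDensityᵥ hd
    have h2 : μ.variation.withDensity 1 =
        μ.variation.withDensity (fun x => ‖μ.rnDeriv μ.variation x‖ₑ) := by
      rw [← h1, heq]; exact withDensity_one
    rw [withDensity_eq_iff (by fun_prop) hd.1.enorm (by simp)] at h2
    filter_upwards [h2] with x hx
    rw [← toReal_enorm, ← hx]
    simp
  have hm : Measurable (μ.rnDeriv μ.variation) := by
    have : μ.rnDeriv μ.variation = fun x => (((re μ).rnDeriv μ.variation x : ℝ) : ℂ) +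
        (((im μ).rnDeriv μ.variation x : ℝ) : ℂ) * Complex.I :=
      funext fun x => (Complex.re_add_im _).symm
    rw [this]
    have h1 := SignedMeasure.measurable_rnDeriv (re μ) μ.variation
    have h2 := SignedMeasure.measurable_rnDeriv (im μ) μ.variation
    fun_prop
  classical
  -- Changing the density on a null set makes it unimodular everywhere.
  let h : X → ℂ := fun x => if ‖μ.rnDeriv μ.variation x‖ = 1 then μ.rnDeriv μ.variation x else 1
  have hh : Measurable h := Measurable.ite (hm.norm (measurableSet_singleton 1)) hm
    measurable_const
  have hnorm : ∀ x, ‖h x‖ = 1 := fun x => by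
    by_cases hx : ‖μ.rnDeriv μ.variation x‖ = 1 <;> simp [h, hx]
  have hae : h =ᵐ[μ.variation] μ.rnDeriv μ.variation := by
    filter_upwards [hone] with x hx
    simp [h, hx]
  have hset : ∀ s, MeasurableSet s → μ s = ∫ x in s, h x ∂μ.variation := fun s hs => by
    conv_lhs => rw [← heq]
    rw [withDensityᵥ_apply hd hs]
    exact (setIntegral_congr_ae hs (hae.mono fun x hx _ => hx)).symm
  have hmul : ∀ {f : X → ℂ}, Integrable f μ.variation →
      Integrable (fun x => f x * h x) μ.variation := fun hf =>
    hf.mul_bdd (c := 1) hh.aestronglyMeasurable (Filter.Eventually.of_forall fun x => (hnorm x).le)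
  refine ⟨h, hh, hnorm, fun f => ?_⟩
  by_cases hf : Integrable f μ.variation
  -- Both sides are additive and continuous in `f ∈ L^1(|μ|)` and agree on multiples of indicators.
  · refine Integrable.induction (fun f => ∫ᵛ x, f x ∂[ContinuousLinearMap.mul ℝ ℂ; μ] =
      ∫ x, f x * h x ∂μ.variation) ?_ ?_ ?_ ?_ hf
    · intro c s hs hfin
      rw [VectorMeasure.integral_indicator hs]
      rw [VectorMeasure.integral_const, VectorMeasure.restrict_apply _ hs MeasurableSet.univ,
        Set.univ_inter, ContinuousLinearMap.mul_apply', hset s hs, ← integral_const_mul,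
        ← integral_indicator hs]
      refine integral_congr_ae (Filter.Eventually.of_forall fun x => ?_)
      by_cases hx : x ∈ s <;> simp [hx]
    · intro f g _ hf hg ihf ihg
      rw [VectorMeasure.integral_add hf hg, ihf, ihg, ← integral_add (hmul hf) (hmul hg)]
      simp only [Pi.add_apply, add_mul]
    · refine isClosed_eq VectorMeasure.continuous_integral ?_
      have hL : ∀ f : X →₁[μ.variation] ℂ, ∫ x, f x * h x ∂μ.variation =
          ∫ x, (Integrable.toL1 _ (hmul (L1.integrable_coeFn f))) x ∂μ.variation := fun f =>
        integral_congr_ae (Integrable.coeFn_toL1 _).symm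
      simp only [hL]
      refine continuous_integral.comp ?_
      refine LipschitzWith.continuous (K := 1) fun f g => ?_
      rw [Integrable.edist_toL1_toL1, ENNReal.coe_one, one_mul, L1.edist_def]
      refine lintegral_mono fun x => ?_
      rw [edist_eq_enorm_sub, edist_eq_enorm_sub, ← sub_mul, enorm_mul,
        show ‖h x‖ₑ = 1 by rw [← ofReal_norm, hnorm]; simp, mul_one]
    · intro f g hfg hf ih
      rw [← VectorMeasure.integral_congr_ae hfg, ih]
      exact integral_congr_ae (hfg.mono fun x hx => by simp only [hx])
  -- Since `|h| = 1`, `f h` is integrable only if `f` is; otherwise both integrals take the default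
  -- value `0`.
  · rw [VectorMeasure.integral_undef hf, integral_undef]
    refine fun hfh => hf ?_
    have := hfh.mul_bdd (c := 1) (g := fun x => (h x)⁻¹) hh.inv.aestronglyMeasurable
      (Filter.Eventually.of_forall fun x => by simp [hnorm])
    refine this.congr (Filter.Eventually.of_forall fun x => ?_)
    have h0 : h x ≠ 0 := fun h0 => by simpa [h0] using hnorm x
    simp [h0]

end MeasureTheory.ComplexMeasure

/-! ### The kernel and transforms of Schwartz functions. -/

variable {n : ℕ}

theorem norm_fourierKernel (x ξ : EuclideanSpace ℝ (Fin n)) : ‖fourierKernel x ξ‖ = 1 := by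
  rw [fourierKernel, Complex.norm_exp]
  simp

theorem fourierKernel_comm (x ξ : EuclideanSpace ℝ (Fin n)) :
    fourierKernel x ξ = fourierKernel ξ x := by
  rw [fourierKernel, fourierKernel, real_inner_comm]

theorem fourierKernel_smul_left (t : ℝ) (x ξ : EuclideanSpace ℝ (Fin n)) :
    fourierKernel (t • x) ξ = fourierKernel x (t • ξ) := by
  rw [fourierKernel, fourierKernel, real_inner_smul_left, real_inner_smul_right]

theorem fourierKernel_add_left (x y ξ : EuclideanSpace ℝ (Fin n)) :
    fourierKernel (x + y) ξ = fourierKernel x ξ * fourierKernel y ξ := by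
  rw [fourierKernel, fourierKernel, fourierKernel, ← Complex.exp_add, inner_add_left]
  congr 1
  push_cast
  ring

@[fun_prop]
theorem Continuous.fourierKernel {X : Type*} [TopologicalSpace X]
    {u v : X → EuclideanSpace ℝ (Fin n)} (hu : Continuous u) (hv : Continuous v) :
    Continuous fun z => fourierKernel (u z) (v z) := by
  unfold _root_.fourierKernel
  fun_prop

theorem MeasureTheory.Integrable.fourierKernel_mul {f : EuclideanSpace ℝ (Fin n) → ℂ}
    {ρ : Measure (EuclideanSpace ℝ (Fin n))} (hf : Integrable f ρ)
    (ξ : EuclideanSpace ℝ (Fin n)) : Integrable (fun x => fourierKernel x ξ * f x) ρ :=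
  hf.bdd_mul (c := 1) (by fun_prop)
    (Filter.Eventually.of_forall fun x => (norm_fourierKernel x ξ).le)

/-- `𝓕` has kernel `e^{-2πi x·ξ}`; a dilation by `(2π)⁻¹` converts it to the kernel `e^{-i x·ξ}`. -/
theorem schwartzFourier_eq (φ : 𝓢(EuclideanSpace ℝ (Fin n), ℂ)) (x : EuclideanSpace ℝ (Fin n)) :
    schwartzFourier φ x = 𝓕 φ ((2 * Real.pi)⁻¹ • x) := by
  rw [SchwartzMap.fourier_coe, Real.fourier_eq', schwartzFourier]
  refine integral_congr_ae (Filter.Eventually.of_forall fun ξ => ?_)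
  simp only [fourierKernel, smul_eq_mul, real_inner_smul_right, real_inner_comm x ξ]
  congr 2
  have : Real.pi ≠ 0 := Real.pi_ne_zero
  rw [show -2 * Real.pi * ((2 * Real.pi)⁻¹ * inner ℝ x ξ) = -inner ℝ x ξ by field_simp]
  push_cast
  ring

/-- The dilation `x ↦ φ (r x)` of a Schwartz function. -/
noncomputable def SchwartzMap.dilate (r : ℝ) (hr : r ≠ 0)
    (φ : 𝓢(EuclideanSpace ℝ (Fin n), ℂ)) : 𝓢(EuclideanSpace ℝ (Fin n), ℂ) :=
  SchwartzMap.compCLMOfContinuousLinearEquiv ℂ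
    (ContinuousLinearEquiv.smulLeft (R₁ := ℝ) (Units.mk0 r hr)) φ

@[simp]
theorem SchwartzMap.dilate_apply (r : ℝ) (hr : r ≠ 0) (φ : 𝓢(EuclideanSpace ℝ (Fin n), ℂ))
    (x : EuclideanSpace ℝ (Fin n)) : φ.dilate r hr x = φ (r • x) := rfl

/-- `schwartzFourier φ` as a Schwartz function. -/
noncomputable def schwartzFourierMap (φ : 𝓢(EuclideanSpace ℝ (Fin n), ℂ)) :
    𝓢(EuclideanSpace ℝ (Fin n), ℂ) :=
  (𝓕 φ).dilate (2 * Real.pi)⁻¹ (by positivity)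

theorem coe_schwartzFourierMap (φ : 𝓢(EuclideanSpace ℝ (Fin n), ℂ)) :
    ⇑(schwartzFourierMap φ) = schwartzFourier φ :=
  funext fun x => (schwartzFourier_eq φ x).symm

theorem MeasureTheory.MemLp.integrable_mul_schwartz {p : ℝ≥0∞} (hp : 1 ≤ p)
    {f : EuclideanSpace ℝ (Fin n) → ℂ} (hf : MemLp f p volume)
    (φ : 𝓢(EuclideanSpace ℝ (Fin n), ℂ)) : Integrable (fun x => f x * φ x) volume :=
  have := ENNReal.HolderConjugate.conjExponent hp
  hf.integrable_mul (φ.memLp p.conjExponent volume)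

theorem MeasureTheory.MemLp.integrable_mul_schwartzFourier {p : ℝ≥0∞} (hp : 1 ≤ p)
    {f : EuclideanSpace ℝ (Fin n) → ℂ} (hf : MemLp f p volume)
    (φ : 𝓢(EuclideanSpace ℝ (Fin n), ℂ)) :
    Integrable (fun x => f x * schwartzFourier φ x) volume := by
  simpa only [coe_schwartzFourierMap] using hf.integrable_mul_schwartz hp (schwartzFourierMap φ)

/-- Test with a smooth bump that equals `1` on a ball around the point. -/
theorem locallyIntegrable_of_integrable_mul_schwartz {g : EuclideanSpace ℝ (Fin n) → ℂ}
    (hg : ∀ φ : 𝓢(EuclideanSpace ℝ (Fin n), ℂ), Integrable (fun ξ => g ξ * φ ξ) volume) :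
    LocallyIntegrable g volume := by
  intro x
  let b : ContDiffBump x := ⟨1, 2, by norm_num, by norm_num⟩
  have hb : HasCompactSupport (fun y => (b y : ℂ)) :=
    b.hasCompactSupport.comp_left Complex.ofReal_zero
  have hb' : ContDiff ℝ (⊤ : ℕ∞) (fun y => (b y : ℂ)) :=
    Complex.ofRealCLM.contDiff.comp b.contDiff
  refine ⟨Metric.closedBall x 1, Metric.closedBall_mem_nhds x one_pos, ?_⟩
  refine ((hg (hb.toSchwartzMap hb')).integrableOn).congr_fun (fun y hy => ?_)
    Metric.isClosed_closedBall.measurableSet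
  have : b y = 1 := b.one_of_mem_closedBall hy
  change g y * (b y : ℂ) = g y
  simp [this]

/-! ### Distributional transforms: uniqueness, sums, and the `L^1` case. -/

namespace IsFourierTransform

variable {f f₁ f₂ g g₁ g₂ : EuclideanSpace ℝ (Fin n) → ℂ}

theorem congr_left (h : IsFourierTransform f₁ g) (hf : f₁ =ᵐ[volume] f₂) :
    IsFourierTransform f₂ g where
  aestronglyMeasurable := h.aestronglyMeasurable
  integrable_mul := h.integrable_mul
  pairing_eq φ := (h.pairing_eq φ).trans (integral_congr_ae (hf.mono fun x hx => by simp only [hx]))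

/-- Smooth compactly supported functions are Schwartz, and they separate locally integrable
functions up to null sets. -/
theorem ae_eq (h₁ : IsFourierTransform f g₁) (h₂ : IsFourierTransform f g₂) :
    g₁ =ᵐ[volume] g₂ := by
  refine ae_eq_of_integral_contDiff_smul_eq
    (locallyIntegrable_of_integrable_mul_schwartz h₁.integrable_mul)
    (locallyIntegrable_of_integrable_mul_schwartz h₂.integrable_mul) fun b hb hbc => ?_
  have hb' : HasCompactSupport (fun y => (b y : ℂ)) := hbc.comp_left Complex.ofReal_zero
  have hb'' : ContDiff ℝ (⊤ : ℕ∞) (fun y => (b y : ℂ)) := Complex.ofRealCLM.contDiff.comp hb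
  have key := (h₁.pairing_eq (hb'.toSchwartzMap hb'')).trans
    (h₂.pairing_eq (hb'.toSchwartzMap hb'')).symm
  have hs : ∀ g : EuclideanSpace ℝ (Fin n) → ℂ, ∫ x, b x • g x =
      ∫ x, g x * (hb'.toSchwartzMap hb'') x := fun g =>
    integral_congr_ae (Filter.Eventually.of_forall fun x => by
      change b x • g x = g x * (b x : ℂ)
      rw [Complex.real_smul, mul_comm])
  rw [hs, hs, key]

/-- Two exponents are allowed because `f` will be split into an `L^1` part and an `L^2` part. -/
theorem add {p₁ p₂ : ℝ≥0∞} (hp₁ : 1 ≤ p₁) (hp₂ : 1 ≤ p₂) (hf₁ : MemLp f₁ p₁ volume)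
    (hf₂ : MemLp f₂ p₂ volume) (h₁ : IsFourierTransform f₁ g₁) (h₂ : IsFourierTransform f₂ g₂) :
    IsFourierTransform (fun x => f₁ x + f₂ x) (fun ξ => g₁ ξ + g₂ ξ) where
  aestronglyMeasurable := h₁.aestronglyMeasurable.add h₂.aestronglyMeasurable
  integrable_mul φ := by
    simp only [add_mul]
    exact (h₁.integrable_mul φ).add (h₂.integrable_mul φ)
  pairing_eq φ := by
    simp only [add_mul]
    rw [integral_add (h₁.integrable_mul φ) (h₂.integrable_mul φ), h₁.pairing_eq, h₂.pairing_eq,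
      integral_add (hf₁.integrable_mul_schwartzFourier hp₁ φ)
        (hf₂.integrable_mul_schwartzFourier hp₂ φ)]

/-- The Fourier transform of an integrable function is given by the usual integral. -/
theorem of_integrable (hf : Integrable f volume) :
    IsFourierTransform f (fun ξ => ∫ x, fourierKernel x ξ * f x) := by
  have hint : ∀ φ : 𝓢(EuclideanSpace ℝ (Fin n), ℂ), Integrable
      (fun z : EuclideanSpace ℝ (Fin n) × EuclideanSpace ℝ (Fin n) =>
        fourierKernel z.2 z.1 * f z.2 * φ z.1) (volume.prod volume) := fun φ => by
    have h1 : Integrable (fun z : EuclideanSpace ℝ (Fin n) × EuclideanSpace ℝ (Fin n) =>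
        φ z.1 * f z.2) (volume.prod volume) := φ.integrable.mul_prod hf
    refine (h1.bdd_mul (c := 1) (f := fun z => fourierKernel z.2 z.1)
      (Continuous.aestronglyMeasurable (by fun_prop))
      (Filter.Eventually.of_forall fun z => (norm_fourierKernel _ _).le)).congr
      (Filter.Eventually.of_forall fun z => by simp only; ring)
  have hpair : ∀ (φ : 𝓢(EuclideanSpace ℝ (Fin n), ℂ)) ξ,
      ∫ x, fourierKernel x ξ * f x * φ ξ = (∫ x, fourierKernel x ξ * f x) * φ ξ :=
    fun φ ξ => integral_mul_const _ _
  refine ⟨?_, fun φ => ?_, fun φ => ?_⟩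
  · have hc : Continuous fun ξ => ∫ x, fourierKernel x ξ * f x := by
      refine continuous_of_dominated (bound := fun x => ‖f x‖)
        (fun ξ => (hf.fourierKernel_mul ξ).1)
        (fun ξ => Filter.Eventually.of_forall fun x => ?_) hf.norm
        (Filter.Eventually.of_forall fun x => by fun_prop)
      rw [norm_mul, norm_fourierKernel, one_mul]
    exact hc.aestronglyMeasurable
  · refine (hint φ).integral_prod_left.congr (Filter.Eventually.of_forall fun ξ => hpair φ ξ)
  · simp only [← hpair]
    rw [integral_integral_swap (hint φ)]
    refine integral_congr_ae (Filter.Eventually.of_forall fun x => ?_)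
    simp only [schwartzFourier]
    rw [← integral_const_mul]
    refine integral_congr_ae (Filter.Eventually.of_forall fun ξ => ?_)
    simp only
    rw [fourierKernel_comm]
    ring

theorem enorm_le_of_integrable (hf : Integrable f volume) (h : IsFourierTransform f g) :
    ∀ᵐ ξ, ‖g ξ‖ₑ ≤ ∫⁻ x, ‖f x‖ₑ := by
  filter_upwards [h.ae_eq (of_integrable hf)] with ξ hξ
  rw [hξ]
  refine (enorm_integral_le_lintegral_enorm _).trans (lintegral_mono fun x => ?_)
  rw [enorm_mul, ← ofReal_norm (fourierKernel x ξ), norm_fourierKernel]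
  simp

end IsFourierTransform

/-! ### Dilations and Plancherel. -/

theorem eLpNorm_comp_smul_eq (f : EuclideanSpace ℝ (Fin n) → ℂ) {r : ℝ} (hr : r ≠ 0) (p : ℝ≥0∞)
    (hp : p ≠ ∞) (hf : AEStronglyMeasurable f volume) :
    eLpNorm (fun x => f (r • x)) p volume =
      ENNReal.ofReal |(r ^ n)⁻¹| ^ (1 / p).toReal * eLpNorm f p volume := by
  have hmap := Measure.map_addHaar_smul (volume : Measure (EuclideanSpace ℝ (Fin n))) hr
  rw [finrank_euclideanSpace_fin] at hmap
  have h1 := eLpNorm_map_measure (μ := volume) (p := p) (g := f)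
    (f := fun x : EuclideanSpace ℝ (Fin n) => r • x)
    (by rw [hmap]; exact hf.smul_measure _) (by fun_prop)
  rw [hmap, eLpNorm_smul_measure_of_ne_top hp, smul_eq_mul] at h1
  exact h1.symm

theorem MeasureTheory.MemLp.comp_smul {f : EuclideanSpace ℝ (Fin n) → ℂ} {r : ℝ} (hr : r ≠ 0)
    {p : ℝ≥0∞} (hp : p ≠ ∞) (hf : MemLp f p volume) : MemLp (fun x => f (r • x)) p volume := by
  refine ⟨hf.1.comp_quasiMeasurePreserving ⟨by fun_prop, ?_⟩, ?_⟩
  · rw [Measure.map_addHaar_smul _ hr]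
    exact Measure.smul_absolutelyContinuous
  · rw [eLpNorm_comp_smul_eq f hr p hp hf.1]
    exact ENNReal.mul_lt_top (ENNReal.rpow_lt_top_of_nonneg (by positivity) ENNReal.ofReal_ne_top)
      hf.2

/-- Plancherel's theorem, up to the value of the constant. -/
theorem exists_isFourierTransform_of_memLp_two (n : ℕ) : ∃ K : ℝ≥0,
    ∀ f : EuclideanSpace ℝ (Fin n) → ℂ, MemLp f 2 volume → ∃ g, IsFourierTransform f g ∧
      MemLp g 2 volume ∧ eLpNorm g 2 volume ≤ K * eLpNorm f 2 volume := by
  have hpi : 2 * Real.pi ≠ 0 := by positivity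
  -- The substitution `x = 2πy` gives `f̂ = (2π)^n 𝓕(f(2π ·))`, so the transform is `c • 𝓕 F` with
  -- `F = f(2π ·)`.
  set c : ℂ := (((2 * Real.pi) ^ n : ℝ) : ℂ) with hc
  have hfin : ENNReal.ofReal |((2 * Real.pi) ^ n)⁻¹| ^ (1 / (2 : ℝ≥0∞)).toReal ≠ ∞ :=
    (ENNReal.rpow_lt_top_of_nonneg (by positivity) ENNReal.ofReal_ne_top).ne
  refine ⟨‖c‖₊ * (ENNReal.ofReal |((2 * Real.pi) ^ n)⁻¹| ^ (1 / (2 : ℝ≥0∞)).toReal).toNNReal,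
    fun f hf => ?_⟩
  have hf' := hf.comp_smul hpi (by simp)
  set F : Lp ℂ 2 (volume : Measure (EuclideanSpace ℝ (Fin n))) := hf'.toLp with hF
  have hG : MemLp (fun ξ => c * (𝓕 F : Lp ℂ 2 (volume : Measure (EuclideanSpace ℝ (Fin n)))) ξ) 2
    volume := (Lp.memLp (𝓕 F)).const_mul c
  refine ⟨_, ⟨hG.1, fun φ => hG.integrable_mul_schwartz (by norm_num) φ, fun φ => ?_⟩, hG, ?_⟩
  · have h1 := congrArg (fun T : TemperedDistribution _ _ => T φ)
      (Lp.fourier_toTemperedDistribution_eq F)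
    simp only [TemperedDistribution.fourier_apply, Lp.toTemperedDistribution_apply,
      smul_eq_mul] at h1
    calc ∫ ξ, c * (𝓕 F : Lp ℂ 2 (volume : Measure (EuclideanSpace ℝ (Fin n)))) ξ * φ ξ
        = c * ∫ ξ, φ ξ * (𝓕 F : Lp ℂ 2 (volume : Measure (EuclideanSpace ℝ (Fin n)))) ξ := by
          rw [← integral_const_mul]
          refine integral_congr_ae (Filter.Eventually.of_forall fun ξ => ?_)
          simp only
          ring
      _ = c * ∫ x, f ((2 * Real.pi) • x) * schwartzFourier φ ((2 * Real.pi) • x) := by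
          rw [← h1]
          congr 1
          refine integral_congr_ae ?_
          filter_upwards [hf'.coeFn_toLp] with x hx
          rw [hF, hx, schwartzFourier_eq, smul_smul, inv_mul_cancel₀ hpi, one_smul, mul_comm]
      _ = ∫ x, f x * schwartzFourier φ x := by
          rw [Measure.integral_comp_smul volume (fun x => f x * schwartzFourier φ x),
            finrank_euclideanSpace_fin, Complex.real_smul, ← mul_assoc, hc, ← Complex.ofReal_mul,
            abs_of_nonneg (by positivity), mul_inv_cancel₀ (by positivity), Complex.ofReal_one,
            one_mul]
  · have h2 : eLpNorm (𝓕 F : Lp ℂ 2 (volume : Measure (EuclideanSpace ℝ (Fin n)))) 2 volume =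
        eLpNorm F 2 volume := by
      rw [← Lp.enorm_def, ← Lp.enorm_def, ← ofReal_norm, ← ofReal_norm, Lp.norm_fourier_eq]
    have h3 := eLpNorm_const_smul c
      (𝓕 F : Lp ℂ 2 (volume : Measure (EuclideanSpace ℝ (Fin n)))) 2 volume
    refine (le_of_eq h3).trans ?_
    rw [h2, hF, eLpNorm_congr_ae hf'.coeFn_toLp, eLpNorm_comp_smul_eq f hpi 2 (by simp) hf.1,
      ENNReal.coe_mul, ENNReal.coe_toNNReal hfin, mul_assoc]
    rfl

/-! ### Marcinkiewicz interpolation and truncations. -/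

theorem lintegral_Ioo_rpow {r a : ℝ} (hr : -1 < r) (ha : 0 ≤ a) :
    ∫⁻ t in Set.Ioo 0 a, ENNReal.ofReal (t ^ r) = ENNReal.ofReal (a ^ (r + 1) / (r + 1)) := by
  have hi : IntegrableOn (fun t : ℝ => t ^ r) (Set.Ioc 0 a) := by
    have := intervalIntegral.intervalIntegrable_rpow' (a := 0) (b := a) hr
    rwa [intervalIntegrable_iff_integrableOn_Ioc_of_le ha] at this
  rw [setLIntegral_congr Ioo_ae_eq_Ioc, ← ofReal_integral_eq_lintegral_ofReal hi,
    ← intervalIntegral.integral_of_le ha, integral_rpow (Or.inl hr),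
    Real.zero_rpow (by linarith), sub_zero]
  filter_upwards [ae_restrict_mem measurableSet_Ioc] with t ht
  exact Real.rpow_nonneg ht.1.le _

theorem lintegral_Ioi_rpow {r a : ℝ} (hr : r < -1) (ha : 0 < a) :
    ∫⁻ t in Set.Ioi a, ENNReal.ofReal (t ^ r) = ENNReal.ofReal (-a ^ (r + 1) / (r + 1)) := by
  rw [← ofReal_integral_eq_lintegral_ofReal (integrableOn_Ioi_rpow_of_lt hr ha),
    integral_Ioi_rpow_of_lt hr ha]
  filter_upwards [ae_restrict_mem measurableSet_Ioi] with t ht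
  exact Real.rpow_nonneg (ha.trans ht).le _

/-- Marcinkiewicz interpolation between a weak-type `(1, 1)` and a weak-type `(2, 2)` bound. -/
theorem lintegral_rpow_le_of_truncated_weak_type {X Y : Type*} [MeasurableSpace X]
    [MeasurableSpace Y] (m : Measure X) [SFinite m] (ν : Measure Y) {F : X → ℝ} {h : Y → ℝ}
    (hF : Measurable F) (hF0 : ∀ x, 0 ≤ F x) (hh : Measurable h) (hh0 : ∀ y, 0 ≤ h y)
    (A B : ℝ≥0∞) {p : ℝ} (hp1 : 1 < p) (hp2 : p < 2)
    (H : ∀ s : ℝ, 0 < s → ν {y | s < h y} ≤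
      A * ENNReal.ofReal s⁻¹ * ∫⁻ x, ENNReal.ofReal (if s < F x then F x else 0) ∂m +
      B * ENNReal.ofReal (s ^ 2)⁻¹ * ∫⁻ x, ENNReal.ofReal (if F x ≤ s then F x ^ 2 else 0) ∂m) :
    ∫⁻ y, ENNReal.ofReal (h y ^ p) ∂ν ≤ ENNReal.ofReal p *
      (A * ENNReal.ofReal (p - 1)⁻¹ + B * ENNReal.ofReal (2 - p)⁻¹) *
        ∫⁻ x, ENNReal.ofReal (F x ^ p) ∂m := by
  rw [lintegral_rpow_eq_lintegral_meas_lt_mul ν (Filter.Eventually.of_forall hh0) hh.aemeasurable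
    (by linarith), mul_assoc]
  refine mul_le_mul_right ?_ _
  -- The layer cake weight `s^{p-1}` times the factors `s⁻¹` and `s⁻²` of `H`. Tonelli then lets the
  -- integral in `s` be taken first.
  let k₁ : ℝ → X → ℝ≥0∞ := fun s x =>
    ENNReal.ofReal (s ^ (p - 2) * if s < F x then F x else 0)
  let k₂ : ℝ → X → ℝ≥0∞ := fun s x =>
    ENNReal.ofReal (s ^ (p - 3) * if F x ≤ s then F x ^ 2 else 0)
  have hk₁ : Measurable (Function.uncurry k₁) := by
    have hs : MeasurableSet {z : ℝ × X | z.1 < F z.2} :=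
      measurableSet_lt measurable_fst (hF.comp measurable_snd)
    have hm : Measurable fun z : ℝ × X => if z.1 < F z.2 then F z.2 else 0 :=
      Measurable.ite hs (hF.comp measurable_snd) measurable_const
    exact ((measurable_fst.pow_const (p - 2)).mul hm).ennreal_ofReal
  have hk₂ : Measurable (Function.uncurry k₂) := by
    have hs : MeasurableSet {z : ℝ × X | F z.2 ≤ z.1} :=
      measurableSet_le (hF.comp measurable_snd) measurable_fst
    have hm : Measurable fun z : ℝ × X => if F z.2 ≤ z.1 then F z.2 ^ 2 else 0 :=
      Measurable.ite hs ((hF.comp measurable_snd).pow_const 2) measurable_const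
    exact ((measurable_fst.pow_const (p - 3)).mul hm).ennreal_ofReal
  -- Here `p > 1` makes `s^{p-2}` integrable at `0`.
  have hin₁ : ∀ x, ∫⁻ s in Set.Ioi 0, k₁ s x ≤
      ENNReal.ofReal (p - 1)⁻¹ * ENNReal.ofReal (F x ^ p) := fun x => by
    have h1 : ∀ s ∈ Set.Ioi (0 : ℝ), k₁ s x ≤ (Set.Ioo 0 (F x)).indicator
        (fun s => ENNReal.ofReal (F x) * ENNReal.ofReal (s ^ (p - 2))) s := fun s hs => by
      have hs : 0 < s := hs
      by_cases hsF : s < F x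
      · rw [Set.indicator_of_mem (show s ∈ Set.Ioo 0 (F x) from ⟨hs, hsF⟩)]
        simp only [k₁, if_pos hsF]
        rw [mul_comm, ENNReal.ofReal_mul (hF0 x)]
      · simp [k₁, if_neg hsF]
    refine (setLIntegral_mono' measurableSet_Ioi h1).trans ((setLIntegral_le_lintegral _ _).trans ?_)
    rw [lintegral_indicator measurableSet_Ioo, lintegral_const_mul' _ _ ENNReal.ofReal_ne_top,
      lintegral_Ioo_rpow (by linarith) (hF0 x), ← ENNReal.ofReal_mul (hF0 x),
      ← ENNReal.ofReal_mul (inv_nonneg.2 (by linarith))]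
    refine ENNReal.ofReal_le_ofReal (le_of_eq ?_)
    rw [show p - 2 + 1 = p - 1 by ring, ← mul_div_assoc, mul_comm (F x),
      ← Real.rpow_add_one' (hF0 x) (by linarith), sub_add_cancel, div_eq_inv_mul]
  -- Here `p < 2` makes `s^{p-3}` integrable at infinity.
  have hin₂ : ∀ x, ∫⁻ s in Set.Ioi 0, k₂ s x ≤
      ENNReal.ofReal (2 - p)⁻¹ * ENNReal.ofReal (F x ^ p) := fun x => by
    rcases (hF0 x).eq_or_lt with h0 | h0
    · simp [k₂, ← h0]
    have h1 : ∀ s ∈ Set.Ioi (0 : ℝ), k₂ s x ≤ (Set.Ici (F x)).indicator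
        (fun s => ENNReal.ofReal (F x ^ 2) * ENNReal.ofReal (s ^ (p - 3))) s := fun s hs => by
      by_cases hsF : F x ≤ s
      · rw [Set.indicator_of_mem (show s ∈ Set.Ici (F x) from hsF)]
        simp only [k₂, if_pos hsF]
        rw [mul_comm, ENNReal.ofReal_mul (by positivity)]
      · simp [k₂, if_neg hsF]
    refine (setLIntegral_mono' measurableSet_Ioi h1).trans ((setLIntegral_le_lintegral _ _).trans ?_)
    rw [lintegral_indicator measurableSet_Ici, lintegral_const_mul' _ _ ENNReal.ofReal_ne_top,
      ← restrict_Ioi_eq_restrict_Ici, lintegral_Ioi_rpow (by linarith) h0,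
      ← ENNReal.ofReal_mul (by positivity), ← ENNReal.ofReal_mul (inv_nonneg.2 (by linarith))]
    refine ENNReal.ofReal_le_ofReal (le_of_eq ?_)
    have h2 : F x ^ p = F x ^ 2 * F x ^ (p - 2) := by
      rw [← Real.rpow_natCast (F x) 2, ← Real.rpow_add h0]
      congr 1
      push_cast
      ring
    rw [h2, show p - 3 + 1 = -(2 - p) by ring, div_neg, neg_div, neg_neg, neg_sub]
    field_simp
  calc ∫⁻ s in Set.Ioi 0, ν {y | s < h y} * ENNReal.ofReal (s ^ (p - 1))
      ≤ ∫⁻ s in Set.Ioi 0, (A * (∫⁻ x, k₁ s x ∂m) + B * ∫⁻ x, k₂ s x ∂m) := by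
        refine setLIntegral_mono' measurableSet_Ioi fun s hs => ?_
        have hs : 0 < s := hs
        refine (mul_le_mul_left (H s hs) _).trans (le_of_eq ?_)
        simp only [k₁, k₂, ENNReal.ofReal_mul (Real.rpow_nonneg hs.le _)]
        rw [lintegral_const_mul' _ _ ENNReal.ofReal_ne_top,
          lintegral_const_mul' _ _ ENNReal.ofReal_ne_top, add_mul]
        have e1 : ENNReal.ofReal (s ^ (p - 2)) =
            ENNReal.ofReal s⁻¹ * ENNReal.ofReal (s ^ (p - 1)) := by
          rw [← ENNReal.ofReal_mul (inv_nonneg.2 hs.le), ← Real.rpow_neg_one,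
            ← Real.rpow_add hs]
          congr 2
          ring
        have e2 : ENNReal.ofReal (s ^ (p - 3)) =
            ENNReal.ofReal (s ^ 2)⁻¹ * ENNReal.ofReal (s ^ (p - 1)) := by
          rw [← ENNReal.ofReal_mul (by positivity), ← Real.rpow_natCast, ← Real.rpow_neg hs.le,
            ← Real.rpow_add hs]
          congr 2
          push_cast
          ring
        rw [e1, e2]
        ring
    _ = A * (∫⁻ x, (∫⁻ s in Set.Ioi 0, k₁ s x) ∂m) +
        B * ∫⁻ x, (∫⁻ s in Set.Ioi 0, k₂ s x) ∂m := by
        have m₁ : Measurable fun s => ∫⁻ x, k₁ s x ∂m := hk₁.lintegral_prod_right'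
        have m₂ : Measurable fun s => ∫⁻ x, k₂ s x ∂m := hk₂.lintegral_prod_right'
        rw [lintegral_add_left (m₁.const_mul A), lintegral_const_mul _ m₁,
          lintegral_const_mul _ m₂, lintegral_lintegral_swap hk₁.aemeasurable,
          lintegral_lintegral_swap hk₂.aemeasurable]
    _ ≤ A * (∫⁻ x, ENNReal.ofReal (p - 1)⁻¹ * ENNReal.ofReal (F x ^ p) ∂m) +
        B * ∫⁻ x, ENNReal.ofReal (2 - p)⁻¹ * ENNReal.ofReal (F x ^ p) ∂m := by
        gcongr with x x
        · exact hin₁ x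
        · exact hin₂ x
    _ = _ := by
        rw [lintegral_const_mul' _ _ ENNReal.ofReal_ne_top,
          lintegral_const_mul' _ _ ENNReal.ofReal_ne_top]
        ring

/-- By the layer cake formula the integral is at most `∫_0^b 2s · s⁻¹ ds`. In Paley's inequality
this controls the `φ² dξ`-measure of `{φ < b}`. -/
theorem lintegral_sq_sublevel_le {Y : Type*} [MeasurableSpace Y] (m : Measure Y) {φ : Y → ℝ}
    (hφ : Measurable φ) (hφ0 : ∀ y, 0 ≤ φ y)
    (hw : ∀ s : ℝ, 0 < s → m {y | s < φ y} ≤ ENNReal.ofReal s⁻¹) (b : ℝ) :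
    ∫⁻ y in {y | φ y < b}, ENNReal.ofReal (φ y ^ 2) ∂m ≤ ENNReal.ofReal (2 * b) := by
  have h1 := lintegral_rpow_eq_lintegral_meas_lt_mul (m.restrict {y | φ y < b})
    (Filter.Eventually.of_forall hφ0) hφ.aemeasurable (p := 2) two_pos
  simp only [Real.rpow_two] at h1
  rw [h1, ENNReal.ofReal_mul zero_le_two]
  refine mul_le_mul_right ?_ _
  have h2 : ∀ s ∈ Set.Ioi (0 : ℝ), (m.restrict {y | φ y < b}) {y | s < φ y} *
      ENNReal.ofReal (s ^ ((2 : ℝ) - 1)) ≤ (Set.Ioo 0 b).indicator 1 s := fun s hs => by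
    have hs : 0 < s := hs
    rw [Measure.restrict_apply (measurableSet_lt measurable_const hφ)]
    by_cases hsb : s < b
    · rw [Set.indicator_of_mem (show s ∈ Set.Ioo 0 b from ⟨hs, hsb⟩),
        show (2 : ℝ) - 1 = 1 by norm_num, Real.rpow_one]
      refine (mul_le_mul_left ((measure_mono Set.inter_subset_left).trans (hw s hs)) _).trans ?_
      rw [← ENNReal.ofReal_mul (inv_nonneg.2 hs.le), inv_mul_cancel₀ hs.ne']
      simp
    · have : {y | s < φ y} ∩ {y | φ y < b} = ∅ := by
        ext y
        simp only [Set.mem_inter_iff, Set.mem_ofPred_eq, Set.mem_empty_iff_false, iff_false]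
        rintro ⟨h3, h4⟩
        exact hsb (h3.trans h4)
      simp [this]
  refine (setLIntegral_mono' measurableSet_Ioi h2).trans ((setLIntegral_le_lintegral _ _).trans ?_)
  rw [lintegral_indicator_one measurableSet_Ioo, Real.volume_Ioo, sub_zero]

theorem MeasureTheory.MemLp.integrable_norm_rpow_ofReal {X : Type*} [MeasurableSpace X]
    {m : Measure X} {f : X → ℂ} {p : ℝ} (hp : 0 < p) (hf : MemLp f (ENNReal.ofReal p) m) :
    Integrable (fun x => ‖f x‖ ^ p) m := by
  simpa only [ENNReal.toReal_ofReal hp.le] using hf.integrable_norm_rpow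
    (by simpa using hp) ENNReal.ofReal_ne_top

/-- Where `|f| > s`, `|f| ≤ s^{1-p} |f|^p`. The low part below uses `|f|² ≤ s^{2-p} |f|^p` in the
same way. -/
theorem MeasureTheory.MemLp.integrable_indicator_lt_norm {X : Type*} [MeasurableSpace X]
    {m : Measure X} {f : X → ℂ} {p : ℝ} (hp : 1 ≤ p) (hfm : StronglyMeasurable f)
    (hf : MemLp f (ENNReal.ofReal p) m) {s : ℝ} (hs : 0 < s) :
    Integrable ({x | s < ‖f x‖}.indicator f) m := by
  have hset : MeasurableSet {x | s < ‖f x‖} :=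
    measurableSet_lt measurable_const hfm.norm.measurable
  refine ((hf.integrable_norm_rpow_ofReal (by linarith)).const_mul (s ^ (1 - p))).mono'
    (hfm.indicator hset).aestronglyMeasurable (Filter.Eventually.of_forall fun x => ?_)
  by_cases hx : s < ‖f x‖
  · have hx' : 0 < ‖f x‖ := hs.trans hx
    rw [Set.indicator_of_mem (show x ∈ {x | s < ‖f x‖} from hx)]
    calc ‖f x‖ = ‖f x‖ ^ (1 - p) * ‖f x‖ ^ p := by
          rw [← Real.rpow_add hx', sub_add_cancel, Real.rpow_one]
      _ ≤ s ^ (1 - p) * ‖f x‖ ^ p := by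
          exact mul_le_mul_of_nonneg_right
            (Real.rpow_le_rpow_of_nonpos hs hx.le (sub_nonpos.2 hp)) (by positivity)
  · rw [Set.indicator_of_notMem (show x ∉ {x | s < ‖f x‖} from hx), norm_zero]
    positivity

theorem MeasureTheory.MemLp.memLp_two_indicator_norm_le {X : Type*} [MeasurableSpace X]
    {m : Measure X} {f : X → ℂ} {p : ℝ} (hp : 0 < p) (hp2 : p ≤ 2) (hfm : StronglyMeasurable f)
    (hf : MemLp f (ENNReal.ofReal p) m) {s : ℝ} (hs : 0 < s) :
    MemLp ({x | ‖f x‖ ≤ s}.indicator f) 2 m := by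
  have hset : MeasurableSet {x | ‖f x‖ ≤ s} :=
    measurableSet_le hfm.norm.measurable measurable_const
  rw [memLp_two_iff_integrable_sq_norm (hfm.indicator hset).aestronglyMeasurable]
  refine ((hf.integrable_norm_rpow_ofReal hp).const_mul (s ^ (2 - p))).mono'
    ((hfm.indicator hset).norm.pow 2).aestronglyMeasurable
    (Filter.Eventually.of_forall fun x => ?_)
  by_cases hx : ‖f x‖ ≤ s
  · rw [Set.indicator_of_mem (show x ∈ {x | ‖f x‖ ≤ s} from hx), norm_pow, norm_norm]
    rcases (norm_nonneg (f x)).eq_or_lt with h0 | h0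
    · rw [← h0, zero_pow two_ne_zero]
      positivity
    calc ‖f x‖ ^ 2 = ‖f x‖ ^ (2 - p) * ‖f x‖ ^ p := by
          rw [← Real.rpow_add h0, sub_add_cancel, Real.rpow_two]
      _ ≤ s ^ (2 - p) * ‖f x‖ ^ p := by
          gcongr
  · rw [Set.indicator_of_notMem (show x ∉ {x | ‖f x‖ ≤ s} from hx)]
    simp only [norm_zero, ne_eq, OfNat.ofNat_ne_zero, not_false_eq_true, zero_pow]
    positivity

/-! ### Paley's inequality. -/

namespace IsFourierTransform

theorem congr_right {f g₁ g₂ : EuclideanSpace ℝ (Fin n) → ℂ} (h : IsFourierTransform f g₁)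
    (hg : g₁ =ᵐ[volume] g₂) : IsFourierTransform f g₂ where
  aestronglyMeasurable := h.aestronglyMeasurable.congr hg
  integrable_mul φ := (h.integrable_mul φ).congr (hg.mono fun x hx => by simp only [hx])
  pairing_eq φ := (integral_congr_ae (hg.mono fun x hx => by simp only [hx])).trans
    (h.pairing_eq φ)

/-- Splitting a function in `L^p`, `1 ≤ p ≤ 2`, at height `s`, and its transform accordingly. -/
theorem exists_decomposition {p s : ℝ} (hp : 1 ≤ p) (hp2 : p ≤ 2) (hs : 0 < s) {K : ℝ≥0}
    (hK : ∀ f : EuclideanSpace ℝ (Fin n) → ℂ, MemLp f 2 volume → ∃ g, IsFourierTransform f g ∧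
      MemLp g 2 volume ∧ eLpNorm g 2 volume ≤ K * eLpNorm f 2 volume)
    {f : EuclideanSpace ℝ (Fin n) → ℂ} (hfm : StronglyMeasurable f)
    (hf : MemLp f (ENNReal.ofReal p) volume) :
    ∃ g₁ g₂ : EuclideanSpace ℝ (Fin n) → ℂ, StronglyMeasurable g₂ ∧
      IsFourierTransform f (fun ξ => g₁ ξ + g₂ ξ) ∧
      (∀ᵐ ξ, ‖g₁ ξ‖ₑ ≤ ∫⁻ x, ‖{x | s < ‖f x‖}.indicator f x‖ₑ) ∧
      eLpNorm g₂ 2 volume ≤ K * eLpNorm ({x | ‖f x‖ ≤ s}.indicator f) 2 volume := by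
  have hf₁ := hf.integrable_indicator_lt_norm hp hfm hs
  have hf₂ := hf.memLp_two_indicator_norm_le (by linarith) hp2 hfm hs
  obtain ⟨g₂, hg₂, -, hle⟩ := hK _ hf₂
  have hmk := hg₂.aestronglyMeasurable.ae_eq_mk
  refine ⟨_, hg₂.aestronglyMeasurable.mk g₂, hg₂.aestronglyMeasurable.stronglyMeasurable_mk, ?_,
    enorm_le_of_integrable hf₁ (of_integrable hf₁), by rwa [← eLpNorm_congr_ae hmk]⟩
  refine ((of_integrable hf₁).add le_rfl (by norm_num) (memLp_one_iff_integrable.2 hf₁) hf₂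
    (hg₂.congr_right hmk)).congr_left (Filter.Eventually.of_forall fun x => ?_)
  by_cases hx : s < ‖f x‖
  · simp [Set.indicator, hx, not_le.2 hx]
  · simp [Set.indicator, hx, not_lt.1 hx]

end IsFourierTransform

theorem exists_isFourierTransform_of_memLp {p : ℝ} (hp : 1 ≤ p) (hp2 : p ≤ 2)
    {f : EuclideanSpace ℝ (Fin n) → ℂ} (hf : MemLp f (ENNReal.ofReal p) volume) :
    ∃ g, IsFourierTransform f g := by
  obtain ⟨K, hK⟩ := exists_isFourierTransform_of_memLp_two n
  have hmk := hf.1.ae_eq_mk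
  obtain ⟨g₁, g₂, -, h, -⟩ := IsFourierTransform.exists_decomposition hp hp2 one_pos hK
    hf.1.stronglyMeasurable_mk (hf.ae_eq hmk)
  exact ⟨_, h.congr_left hmk.symm⟩

/-- Paley's inequality for a normalized weight. -/
theorem exists_paley_normalized (n : ℕ) {p : ℝ} (hp1 : 1 < p) (hp2 : p < 2) : ∃ C : ℝ≥0,
    ∀ φ : EuclideanSpace ℝ (Fin n) → ℝ, Measurable φ → (∀ ξ, 0 ≤ φ ξ) →
      (∀ s : ℝ, 0 < s → volume {ξ | s < φ ξ} ≤ ENNReal.ofReal s⁻¹) →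
      ∀ f g : EuclideanSpace ℝ (Fin n) → ℂ, StronglyMeasurable f → StronglyMeasurable g →
        MemLp f (ENNReal.ofReal p) volume → IsFourierTransform f g →
          ∫⁻ ξ, ENNReal.ofReal (‖g ξ‖ ^ p * φ ξ ^ (2 - p)) ≤
            C * ∫⁻ x, ENNReal.ofReal (‖f x‖ ^ p) := by
  obtain ⟨K, hK⟩ := exists_isFourierTransform_of_memLp_two n
  refine ⟨(ENNReal.ofReal p * (4 * ENNReal.ofReal (p - 1)⁻¹ +
    4 * K ^ 2 * ENNReal.ofReal (2 - p)⁻¹)).toNNReal, fun φ hφ hφ0 hw f g hfm hgm hf hfg => ?_⟩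
  rw [ENNReal.coe_toNNReal (by finiteness)]
  -- Where `φ > 0`, `|g|^p φ^{2-p} = (|g|/φ)^p φ²`, so the left side is an `L^p(ν)` integral of
  -- `|g|/φ`. Zeros of `φ` contribute nothing to either side.
  set ν : Measure (EuclideanSpace ℝ (Fin n)) :=
    volume.withDensity fun ξ => ENNReal.ofReal (φ ξ ^ 2) with hν
  have hdens : Measurable fun ξ => ENNReal.ofReal (φ ξ ^ 2) := by fun_prop
  have hνac : ν ≪ volume := withDensity_absolutelyContinuous _ _
  have hhm : Measurable fun ξ => ‖g ξ‖ / φ ξ := hgm.norm.measurable.div hφ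
  have hlhs : ∫⁻ ξ, ENNReal.ofReal (‖g ξ‖ ^ p * φ ξ ^ (2 - p)) =
      ∫⁻ ξ, ENNReal.ofReal ((‖g ξ‖ / φ ξ) ^ p) ∂ν := by
    rw [hν, lintegral_withDensity_eq_lintegral_mul _ hdens (by fun_prop)]
    refine lintegral_congr fun ξ => ?_
    rw [Pi.mul_apply, ← ENNReal.ofReal_mul (by positivity)]
    congr 1
    rcases (hφ0 ξ).eq_or_lt with h0 | h0
    · rw [← h0, Real.zero_rpow (by linarith)]
      simp
    · rw [Real.div_rpow (norm_nonneg _) h0.le, Real.rpow_sub h0, Real.rpow_two]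
      field_simp
  rw [hlhs]
  refine lintegral_rpow_le_of_truncated_weak_type volume ν hfm.norm.measurable
    (fun x => norm_nonneg _) hhm (fun ξ => div_nonneg (norm_nonneg _) (hφ0 ξ)) 4 (4 * K ^ 2)
    hp1 hp2 fun s hs => ?_
  obtain ⟨g₁, g₂, hg₂m, hg, hg₁, hg₂⟩ :=
    IsFourierTransform.exists_decomposition hp1.le hp2.le hs hK hfm hf
  set N := ∫⁻ x, ‖{x | s < ‖f x‖}.indicator f x‖ₑ with hN
  have hNtop : N ≠ ∞ := (hf.integrable_indicator_lt_norm hp1.le hfm hs).2.ne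
  have hN' : N = ∫⁻ x, ENNReal.ofReal (if s < ‖f x‖ then ‖f x‖ else 0) := by
    refine lintegral_congr fun x => ?_
    by_cases hx : s < ‖f x‖ <;> simp [Set.indicator, hx]
  -- Split `f` at the same height `s`. If `φ ≥ 2N/s`, then `|g₁| ≤ N ≤ sφ/2`, so `|g| > sφ` forces
  -- `|g₂| ≥ sφ/2`.
  have hsub : ν {ξ | s < ‖g ξ‖ / φ ξ} ≤ ν {ξ | φ ξ < 2 * N.toReal / s} +
      ν {ξ | ENNReal.ofReal (s ^ 2 / 4) ≤ ENNReal.ofReal ((‖g₂ ξ‖ / φ ξ) ^ 2)} := by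
    refine (measure_mono_ae ?_).trans (measure_union_le _ _)
    filter_upwards [hνac.ae_le (hfg.ae_eq hg), hνac.ae_le hg₁] with ξ h1 h2 h3
    have h3 : s < ‖g ξ‖ / φ ξ := h3
    have hφpos : 0 < φ ξ := by
      refine (hφ0 ξ).lt_of_ne fun h0 => ?_
      rw [← h0, div_zero] at h3
      exact hs.not_gt h3
    have h4 : ‖g₁ ξ‖ ≤ N.toReal := by
      rw [← toReal_enorm]
      exact ENNReal.toReal_mono hNtop h2
    rw [lt_div_iff₀ hφpos, h1] at h3
    by_cases h5 : φ ξ < 2 * N.toReal / s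
    · exact Or.inl h5
    · refine Or.inr (ENNReal.ofReal_le_ofReal ?_)
      rw [not_lt, div_le_iff₀ hs] at h5
      have h6 := norm_add_le (g₁ ξ) (g₂ ξ)
      have h7 : s / 2 ≤ ‖g₂ ξ‖ / φ ξ := by
        rw [le_div_iff₀ hφpos]
        linarith
      calc s ^ 2 / 4 = (s / 2) ^ 2 := by ring
        _ ≤ _ := by gcongr
  refine hsub.trans (add_le_add ?_ ?_)
  -- The first constant is `2 · (2N/s) = 4N/s`; the second, `4K²`, comes from Chebyshev at level
  -- `(s/2)²` and Plancherel.
  · rw [hν, withDensity_apply _ (measurableSet_lt hφ measurable_const)]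
    refine (lintegral_sq_sublevel_le volume hφ hφ0 hw _).trans (le_of_eq ?_)
    rw [← hN']
    conv_rhs => rw [← ENNReal.ofReal_toReal hNtop]
    rw [show (4 : ℝ≥0∞) = ENNReal.ofReal 4 by simp, ← ENNReal.ofReal_mul (by norm_num),
      ← ENNReal.ofReal_mul (by positivity)]
    congr 1
    ring
  · have hs4 : ENNReal.ofReal (s ^ 2 / 4) ≠ 0 := by
      rw [ne_eq, ENNReal.ofReal_eq_zero, not_le]
      positivity
    refine (meas_ge_le_lintegral_div (by fun_prop) hs4 ENNReal.ofReal_ne_top).trans ?_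
    have h1 : ∫⁻ ξ, ENNReal.ofReal ((‖g₂ ξ‖ / φ ξ) ^ 2) ∂ν ≤ ∫⁻ ξ, ‖g₂ ξ‖ₑ ^ (2 : ℝ) := by
      rw [hν, lintegral_withDensity_eq_lintegral_mul _ hdens (by fun_prop)]
      refine lintegral_mono fun ξ => ?_
      rw [Pi.mul_apply, ← ENNReal.ofReal_mul (by positivity), ← ofReal_norm,
        ENNReal.ofReal_rpow_of_nonneg (norm_nonneg _) zero_le_two, Real.rpow_two]
      refine ENNReal.ofReal_le_ofReal ?_
      rcases (hφ0 ξ).eq_or_lt with h0 | h0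
      · rw [← h0]
        simp
      · rw [div_pow, mul_div_cancel₀ _ (by positivity)]
    have h2 : ∫⁻ ξ, ‖g₂ ξ‖ₑ ^ (2 : ℝ) ≤ K ^ 2 *
        ∫⁻ x, ENNReal.ofReal (if ‖f x‖ ≤ s then ‖f x‖ ^ 2 else 0) := by
      have h3 := ENNReal.rpow_le_rpow hg₂ (z := 2) zero_le_two
      rw [ENNReal.mul_rpow_of_nonneg _ _ zero_le_two,
        eLpNorm_eq_lintegral_rpow_enorm_toReal two_ne_zero ENNReal.ofNat_ne_top,
        eLpNorm_eq_lintegral_rpow_enorm_toReal two_ne_zero ENNReal.ofNat_ne_top,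
        ← ENNReal.rpow_mul, ← ENNReal.rpow_mul] at h3
      simp only [ENNReal.toReal_ofNat, one_div, inv_mul_cancel₀ (two_ne_zero' ℝ),
        ENNReal.rpow_one] at h3
      refine h3.trans (le_of_eq ?_)
      rw [ENNReal.rpow_two]
      congr 1
      refine lintegral_congr fun x => ?_
      by_cases hx : ‖f x‖ ≤ s
      · simp only [Set.indicator, Set.mem_ofPred_eq, hx, if_true]
        rw [← ofReal_norm, ENNReal.ofReal_rpow_of_nonneg (norm_nonneg _) zero_le_two,
          Real.rpow_two]
      · simp [Set.indicator, hx]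
    refine (ENNReal.div_le_div_right (h1.trans h2) _).trans (le_of_eq ?_)
    have h4 : (ENNReal.ofReal (s ^ 2 / 4))⁻¹ = 4 * ENNReal.ofReal (s ^ 2)⁻¹ := by
      rw [← ENNReal.ofReal_inv_of_pos (by positivity), show (4 : ℝ≥0∞) = ENNReal.ofReal 4 by simp,
        ← ENNReal.ofReal_mul (by norm_num)]
      congr 1
      field_simp
    rw [div_eq_mul_inv, h4]
    ring

/-- Paley's inequality. -/
theorem exists_paley (n : ℕ) {p : ℝ} (hp1 : 1 < p) (hp2 : p < 2) : ∃ C : ℝ≥0,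
    ∀ (φ : EuclideanSpace ℝ (Fin n) → ℝ) (M : ℝ), Measurable φ → (∀ ξ, 0 ≤ φ ξ) → 0 < M →
      (∀ s : ℝ, 0 < s → volume {ξ | s < φ ξ} ≤ ENNReal.ofReal (M / s)) →
      ∀ f g : EuclideanSpace ℝ (Fin n) → ℂ,
        MemLp f (ENNReal.ofReal p) volume → IsFourierTransform f g →
          ∫⁻ ξ, ENNReal.ofReal (‖g ξ‖ ^ p * φ ξ ^ (2 - p)) ≤
            C * ENNReal.ofReal (M ^ (2 - p)) * ∫⁻ x, ENNReal.ofReal (‖f x‖ ^ p) := by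
  obtain ⟨C, hC⟩ := exists_paley_normalized n hp1 hp2
  refine ⟨C, fun φ M hφ hφ0 hM hw f g hf hfg => ?_⟩
  have hfm := hf.1.ae_eq_mk
  have hgm := hfg.aestronglyMeasurable.ae_eq_mk
  -- Dividing `φ` by `M` normalizes the weak-type bound; the power `2 - p` of the weight returns
  -- `M^{2-p}`.
  have key := hC (fun ξ => φ ξ / M) (hφ.div_const M) (fun ξ => div_nonneg (hφ0 ξ) hM.le)
    (fun s hs => by
      simp only [lt_div_iff₀ hM]
      refine (hw _ (by positivity)).trans (le_of_eq ?_)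
      congr 1
      field_simp) _ _ hf.1.stronglyMeasurable_mk hfg.aestronglyMeasurable.stronglyMeasurable_mk
      (hf.ae_eq hfm) ((hfg.congr_left hfm).congr_right hgm)
  have e1 : ∫⁻ x, ENNReal.ofReal (‖hf.1.mk f x‖ ^ p) = ∫⁻ x, ENNReal.ofReal (‖f x‖ ^ p) :=
    lintegral_congr_ae (hfm.mono fun x hx => by simp only [hx])
  have e2 : ∫⁻ ξ, ENNReal.ofReal (‖g ξ‖ ^ p * φ ξ ^ (2 - p)) = ENNReal.ofReal (M ^ (2 - p)) *
      ∫⁻ ξ, ENNReal.ofReal (‖hfg.aestronglyMeasurable.mk g ξ‖ ^ p * (φ ξ / M) ^ (2 - p)) := by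
    rw [← lintegral_const_mul' _ _ ENNReal.ofReal_ne_top]
    refine lintegral_congr_ae (hgm.mono fun ξ hξ => ?_)
    simp only [← hξ]
    rw [← ENNReal.ofReal_mul (by positivity), Real.div_rpow (hφ0 ξ) hM.le]
    congr 1
    field_simp
  rw [e2, ← e1, mul_comm (C : ℝ≥0∞), mul_assoc]
  exact mul_le_mul_right key _

/-! ### Hausdorff–Young, Hardy–Littlewood–Paley and Pitt. -/

/-- The Hausdorff–Young inequality for `1 < p < 2`, up to the value of the constant. -/
theorem exists_hausdorff_young (n : ℕ) {p : ℝ} (hp1 : 1 < p) (hp2 : p < 2) : ∃ C : ℝ≥0,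
    ∀ f g : EuclideanSpace ℝ (Fin n) → ℂ,
      MemLp f (ENNReal.ofReal p) volume → IsFourierTransform f g →
        ∫⁻ ξ, ENNReal.ofReal (‖g ξ‖ ^ (p / (p - 1))) ≤
          (C * ∫⁻ x, ENNReal.ofReal (‖f x‖ ^ p)) ^ (p - 1)⁻¹ := by
  obtain ⟨C, hC⟩ := exists_paley n hp1 hp2
  have hp0 : 0 < p - 1 := by linarith
  set r := p / (p - 1) with hr
  have hr0 : 0 < r := by positivity
  -- With `φ = |g|^r` this identity gives `|g|^p φ^{2-p} = φ`, so Paley's inequality bounds `∫ φ` by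
  -- a power of itself.
  have hrp : p + r * (2 - p) = r := by
    rw [hr]
    field_simp
    ring
  refine ⟨C, fun f g₀ hf hfg₀ => ?_⟩
  obtain ⟨g, hgm, hgg⟩ := hfg₀.aestronglyMeasurable
  have hfg := hfg₀.congr_right hgg
  rw [lintegral_congr_ae (hgg.mono fun ξ hξ => show ENNReal.ofReal (‖g₀ ξ‖ ^ r) =
    ENNReal.ofReal (‖g ξ‖ ^ r) by rw [hξ])]
  -- Truncating in size and support makes the integral `I` of the weight finite, so that powers of
  -- `I` can be cancelled.
  let ψ : ℕ → EuclideanSpace ℝ (Fin n) → ℝ := fun N =>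
    (Metric.ball 0 (N : ℝ)).indicator fun ξ => min ‖g ξ‖ N ^ r
  have hψm : ∀ N, Measurable (ψ N) := fun N =>
    ((hgm.norm.measurable.min measurable_const).pow_const r).indicator Metric.isOpen_ball.measurableSet
  have hψ0 : ∀ N ξ, 0 ≤ ψ N ξ := fun N ξ => Set.indicator_nonneg (fun ξ _ => by positivity) ξ
  have hbound : ∀ N, ∫⁻ ξ, ENNReal.ofReal (ψ N ξ) ≤
      (C * ∫⁻ x, ENNReal.ofReal (‖f x‖ ^ p)) ^ (p - 1)⁻¹ := fun N => by
    set I := ∫⁻ ξ, ENNReal.ofReal (ψ N ξ) with hI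
    have hItop : I ≠ ∞ := by
      have h1 : I ≤ ∫⁻ ξ, (Metric.ball 0 (N : ℝ)).indicator
          (fun _ : EuclideanSpace ℝ (Fin n) => ENNReal.ofReal ((N : ℝ) ^ r)) ξ := by
        refine lintegral_mono fun ξ => ?_
        by_cases hξ : ξ ∈ Metric.ball (0 : EuclideanSpace ℝ (Fin n)) (N : ℝ)
        · simp only [ψ, Set.indicator_of_mem hξ]
          gcongr
          exact min_le_right _ _
        · simp only [ψ, Set.indicator_of_notMem hξ, ENNReal.ofReal_zero, le_refl]
      refine (h1.trans_lt ?_).ne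
      rw [lintegral_indicator Metric.isOpen_ball.measurableSet, setLIntegral_const]
      exact ENNReal.mul_lt_top ENNReal.ofReal_lt_top measure_ball_lt_top
    rcases eq_or_ne I 0 with hI0 | hI0
    · rw [hI0]
      exact zero_le
    have hIpos : 0 < I.toReal := ENNReal.toReal_pos hI0 hItop
    -- By Chebyshev the weak-type constant of the weight may be taken to be its own integral.
    have key := hC (ψ N) I.toReal (hψm N) (hψ0 N) hIpos (fun s hs => by
      have hs' : ENNReal.ofReal s ≠ 0 := by simpa using hs
      refine (measure_mono (fun ξ hξ => ENNReal.ofReal_le_ofReal (le_of_lt hξ) :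
        {ξ | s < ψ N ξ} ⊆ {ξ | ENNReal.ofReal s ≤ ENNReal.ofReal (ψ N ξ)})).trans ?_
      refine (meas_ge_le_lintegral_div (hψm N).ennreal_ofReal.aemeasurable hs'
        ENNReal.ofReal_ne_top).trans (le_of_eq ?_)
      rw [ENNReal.ofReal_div_of_pos hs, ENNReal.ofReal_toReal hItop]) f g hf hfg
    have hlow : I ≤ ∫⁻ ξ, ENNReal.ofReal (‖g ξ‖ ^ p * ψ N ξ ^ (2 - p)) := by
      refine lintegral_mono fun ξ => ENNReal.ofReal_le_ofReal ?_
      by_cases hξ : ξ ∈ Metric.ball (0 : EuclideanSpace ℝ (Fin n)) (N : ℝ)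
      · simp only [ψ, Set.indicator_of_mem hξ]
        have hm : 0 ≤ min ‖g ξ‖ (N : ℝ) := by positivity
        rw [← Real.rpow_mul hm]
        calc min ‖g ξ‖ (N : ℝ) ^ r = min ‖g ξ‖ (N : ℝ) ^ p * min ‖g ξ‖ (N : ℝ) ^ (r * (2 - p)) := by
              rw [← Real.rpow_add' hm (by rw [hrp]; exact hr0.ne'), hrp]
          _ ≤ _ := by
              gcongr
              exact min_le_left _ _
      · simp only [ψ, Set.indicator_of_notMem hξ]
        positivity
    have h2 := hlow.trans key
    rw [← ENNReal.ofReal_rpow_of_pos hIpos, ENNReal.ofReal_toReal hItop] at h2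
    -- Cancel `I^{2-p}` in `I ≤ C I^{2-p} ∫ |f|^p`.
    have h3 : I ^ (p - 1) ≤ C * ∫⁻ x, ENNReal.ofReal (‖f x‖ ^ p) := by
      have h4 : I ^ (p - 1) = I * I ^ (-(2 - p)) := by
        conv_rhs => rw [← ENNReal.rpow_one I, ← ENNReal.rpow_mul, ← ENNReal.rpow_add _ _ hI0 hItop]
        congr 1
        ring
      rw [h4]
      refine (mul_le_mul_left h2 _).trans (le_of_eq ?_)
      rw [mul_right_comm, mul_assoc (C : ℝ≥0∞), ← ENNReal.rpow_add _ _ hI0 hItop,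
        add_neg_cancel, ENNReal.rpow_zero, mul_one]
    calc I = (I ^ (p - 1)) ^ (p - 1)⁻¹ := by
          rw [← ENNReal.rpow_mul, mul_inv_cancel₀ hp0.ne', ENNReal.rpow_one]
      _ ≤ _ := ENNReal.rpow_le_rpow h3 (by positivity)
  have hmono : ∀ ξ, Monotone fun N => ENNReal.ofReal (ψ N ξ) := fun ξ N N' hN => by
    have hN' : (N : ℝ) ≤ N' := by exact_mod_cast hN
    refine ENNReal.ofReal_le_ofReal ?_
    by_cases hξ : ξ ∈ Metric.ball (0 : EuclideanSpace ℝ (Fin n)) (N : ℝ)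
    · simp only [ψ, Set.indicator_of_mem hξ, Set.indicator_of_mem (Metric.ball_subset_ball hN' hξ)]
      gcongr
    · simp only [ψ, Set.indicator_of_notMem hξ]
      exact hψ0 N' ξ
  refine le_of_tendsto' (lintegral_tendsto_of_tendsto_of_monotone
    (fun N => (hψm N).ennreal_ofReal.aemeasurable) (Filter.Eventually.of_forall hmono)
    (Filter.Eventually.of_forall fun ξ => ?_)) hbound
  refine tendsto_const_nhds.congr' ?_
  obtain ⟨N₀, hN₀⟩ := exists_nat_gt (max ‖ξ‖ ‖g ξ‖)
  filter_upwards [Filter.eventually_ge_atTop N₀] with N hN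
  have hN' : max ‖ξ‖ ‖g ξ‖ < N := hN₀.trans_le (by exact_mod_cast hN)
  have hξ : ξ ∈ Metric.ball (0 : EuclideanSpace ℝ (Fin n)) (N : ℝ) := by
    rw [mem_ball_zero_iff]
    exact (le_max_left _ _).trans_lt hN'
  simp only [ψ, Set.indicator_of_mem hξ]
  rw [min_eq_left ((le_max_right _ _).trans hN'.le)]

/-- The Hardy–Littlewood–Paley inequality for `1 < p < 2`. -/
theorem exists_hardy_littlewood_paley (hn : 0 < n) {p : ℝ} (hp1 : 1 < p) (hp2 : p < 2) :
    ∃ C : ℝ≥0, ∀ f g : EuclideanSpace ℝ (Fin n) → ℂ,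
      MemLp f (ENNReal.ofReal p) volume → IsFourierTransform f g →
        ∫⁻ ξ, ENNReal.ofReal (‖g ξ‖ ^ p * ‖ξ‖ ^ ((n : ℝ) * (p - 2))) ≤
          C * ∫⁻ x, ENNReal.ofReal (‖f x‖ ^ p) := by
  have : Nontrivial (EuclideanSpace ℝ (Fin n)) :=
    Module.nontrivial_of_finrank_pos (R := ℝ) (by rwa [finrank_euclideanSpace_fin])
  obtain ⟨C, hC⟩ := exists_paley n hp1 hp2
  set V := volume (Metric.ball (0 : EuclideanSpace ℝ (Fin n)) 1) with hV
  have hVtop : V ≠ ∞ := measure_ball_lt_top.ne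
  have hVpos : 0 < V.toReal := ENNReal.toReal_pos (Metric.measure_ball_pos _ _ one_pos).ne' hVtop
  refine ⟨C * (ENNReal.ofReal (V.toReal ^ (2 - p))).toNNReal, fun f g hf hfg => ?_⟩
  -- The set `{|ξ|^{-n} > s}` lies in the ball of radius `s^{-1/n}`, whose volume is `V/s`.
  have key := hC (fun ξ => (‖ξ‖ ^ n)⁻¹) V.toReal (by fun_prop) (fun ξ => by positivity) hVpos
    (fun s hs => by
      have hpow : (s ^ (-(n : ℝ)⁻¹)) ^ n = s⁻¹ := by
        rw [← Real.rpow_natCast, ← Real.rpow_mul hs.le, neg_mul,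
          inv_mul_cancel₀ (by exact_mod_cast hn.ne'), Real.rpow_neg_one]
      have hsub : {ξ : EuclideanSpace ℝ (Fin n) | s < (‖ξ‖ ^ n)⁻¹} ⊆
          Metric.ball 0 (s ^ (-(n : ℝ)⁻¹)) := fun ξ hξ => by
        have hξ : s < (‖ξ‖ ^ n)⁻¹ := hξ
        rw [mem_ball_zero_iff]
        refine lt_of_pow_lt_pow_left₀ n (by positivity) ?_
        rw [hpow]
        exact (lt_inv_comm₀ hs (inv_pos.1 (hs.trans hξ))).1 hξ
      refine (measure_mono hsub).trans (le_of_eq ?_)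
      rw [Measure.addHaar_ball _ _ (by positivity), finrank_euclideanSpace_fin, hpow, ← hV,
        ENNReal.ofReal_div_of_pos hs, ENNReal.ofReal_toReal hVtop, ENNReal.ofReal_inv_of_pos hs,
        div_eq_mul_inv, mul_comm]) f g hf hfg
  rw [ENNReal.coe_mul, ENNReal.coe_toNNReal ENNReal.ofReal_ne_top]
  refine le_trans (le_of_eq (lintegral_congr fun ξ => ?_)) key
  congr 2
  rw [Real.inv_rpow (by positivity), ← Real.rpow_natCast, ← Real.rpow_mul (norm_nonneg _),
    ← Real.rpow_neg (norm_nonneg _)]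
  congr 1
  ring

theorem lintegral_ofReal_norm_rpow_eq {X : Type*} [MeasurableSpace X] (m : Measure X) (f : X → ℂ)
    {p : ℝ} (hp : 0 < p) : ∫⁻ x, ENNReal.ofReal (‖f x‖ ^ p) ∂m = eLpNorm f (ENNReal.ofReal p) m ^ p := by
  rw [eLpNorm_eq_lintegral_rpow_enorm_toReal (by simpa using hp) ENNReal.ofReal_ne_top,
    ENNReal.toReal_ofReal hp.le, ← ENNReal.rpow_mul, one_div, inv_mul_cancel₀ hp.ne',
    ENNReal.rpow_one]
  refine lintegral_congr fun x => ?_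
  rw [← ofReal_norm, ENNReal.ofReal_rpow_of_nonneg (norm_nonneg _) hp.le]

theorem aestronglyMeasurable_weighted {p q : ℝ} {g : EuclideanSpace ℝ (Fin n) → ℂ}
    (hg : AEStronglyMeasurable g volume) : AEStronglyMeasurable (weighted p q g) volume := by
  unfold weighted
  have : Measurable fun ξ : EuclideanSpace ℝ (Fin n) =>
      ((‖ξ‖ ^ ((n : ℝ) * (1 - 1 / p - 1 / q)) : ℝ) : ℂ) := by fun_prop
  exact this.aestronglyMeasurable.mul hg

/-- Pitt's inequality in the range `1 < p ≤ 2`, `p ≤ q ≤ p'`. -/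
theorem exists_eLpNorm_weighted_le (hn : 0 < n) {p q : ℝ} (hp1 : 1 < p) (hp2 : p ≤ 2) (hpq : p ≤ q)
    (hqp : q ≤ Real.conjExponent p) : ∃ C : ℝ≥0, ∀ f g : EuclideanSpace ℝ (Fin n) → ℂ,
      MemLp f (ENNReal.ofReal p) volume → IsFourierTransform f g →
        eLpNorm (weighted p q g) (ENNReal.ofReal q) volume ≤
          C * eLpNorm f (ENNReal.ofReal p) volume := by
  have hp0 : 0 < p - 1 := by linarith
  have hq0 : 0 < q := by linarith
  rw [Real.conjExponent] at hqp
  rcases hp2.eq_or_lt with rfl | hp2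
  -- At `p = 2` the range collapses to `q = 2`, and the weight has exponent `0`.
  · obtain rfl : q = 2 := le_antisymm (by norm_num at hqp; exact hqp) hpq
    obtain ⟨K, hK⟩ := exists_isFourierTransform_of_memLp_two n
    refine ⟨K, fun f g hf hfg => ?_⟩
    rw [ENNReal.ofReal_ofNat] at hf ⊢
    obtain ⟨g', hg', -, hle⟩ := hK f hf
    refine le_trans (le_of_eq (eLpNorm_congr_ae ?_)) hle
    filter_upwards [hfg.ae_eq hg'] with ξ hξ
    rw [weighted, hξ]
    norm_num
  obtain ⟨C₁, hC₁⟩ := exists_hardy_littlewood_paley hn hp1 hp2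
  obtain ⟨C₂, hC₂⟩ := exists_hausdorff_young n hp1 hp2
  set r := p / (p - 1) with hr
  have hpr : p < r := by
    rw [hr, lt_div_iff₀ hp0]
    nlinarith
  have hrp : 0 < r - p := by linarith
  -- These are the convex weights with `p a + r b = q`; `hw` checks that they turn the weight
  -- `|ξ|^{n(p-2)}` into the required one.
  set a := (r - q) / (r - p) with ha
  set b := (q - p) / (r - p) with hb
  have ha0 : 0 ≤ a := div_nonneg (by linarith) hrp.le
  have hb0 : 0 ≤ b := div_nonneg (by linarith) hrp.le
  have hab : a + b = 1 := by
    rw [ha, hb]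
    field_simp
    ring
  have hq : p * a + r * b = q := by
    rw [ha, hb]
    field_simp
    ring
  have hw : (n : ℝ) * (p - 2) * a = q * ((n : ℝ) * (1 - 1 / p - 1 / q)) := by
    have h1 : q * (1 - 1 / p - 1 / q) = q / r - 1 := by
      rw [hr]
      field_simp
    have h2 : p / r = p - 1 := by
      rw [hr]
      field_simp
    have hr0 : r ≠ 0 := by positivity
    have h3 : q / r - 1 = (p - 2) * a := by
      rw [← hq, add_div, mul_div_right_comm, h2, mul_div_right_comm, div_self hr0]
      linear_combination hab
    rw [mul_left_comm, h1, h3, mul_assoc]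
  refine ⟨((C₁ : ℝ≥0∞) ^ (a / q) * (C₂ : ℝ≥0∞) ^ ((p - 1)⁻¹ * b / q)).toNNReal,
    fun f g hf hfg => ?_⟩
  have htop : (C₁ : ℝ≥0∞) ^ (a / q) * (C₂ : ℝ≥0∞) ^ ((p - 1)⁻¹ * b / q) ≠ ∞ :=
    ENNReal.mul_ne_top (ENNReal.rpow_ne_top_of_nonneg (by positivity) ENNReal.coe_ne_top)
      (ENNReal.rpow_ne_top_of_nonneg (by positivity) ENNReal.coe_ne_top)
  rw [ENNReal.coe_toNNReal htop]
  have hgn := hfg.aestronglyMeasurable.norm.aemeasurable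
  have key := ENNReal.lintegral_mul_norm_pow_le (μ := volume)
    (f := fun ξ => ENNReal.ofReal (‖g ξ‖ ^ p * ‖ξ‖ ^ ((n : ℝ) * (p - 2))))
    (g := fun ξ => ENNReal.ofReal (‖g ξ‖ ^ r)) (by fun_prop) (by fun_prop) ha0 hb0 hab
  have hlhs : ∀ ξ, ENNReal.ofReal (‖g ξ‖ ^ p * ‖ξ‖ ^ ((n : ℝ) * (p - 2))) ^ a *
      ENNReal.ofReal (‖g ξ‖ ^ r) ^ b = ENNReal.ofReal (‖weighted p q g ξ‖ ^ q) := fun ξ => by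
    rw [ENNReal.ofReal_rpow_of_nonneg (by positivity) ha0,
      ENNReal.ofReal_rpow_of_nonneg (by positivity) hb0, ← ENNReal.ofReal_mul (by positivity),
      Real.mul_rpow (by positivity) (by positivity), weighted, norm_mul, Complex.norm_real,
      Real.norm_of_nonneg (by positivity), Real.mul_rpow (by positivity) (by positivity),
      ← Real.rpow_mul (norm_nonneg _), ← Real.rpow_mul (norm_nonneg _),
      ← Real.rpow_mul (norm_nonneg _), ← Real.rpow_mul (norm_nonneg _), mul_right_comm,
      ← Real.rpow_add' (norm_nonneg _) (by rw [hq]; exact hq0.ne'), hq, hw, mul_comm]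
    congr 3
    ring
  simp only [hlhs] at key
  rw [lintegral_ofReal_norm_rpow_eq _ _ hq0] at key
  have key2 := key.trans (mul_le_mul' (ENNReal.rpow_le_rpow (hC₁ f g hf hfg) ha0)
    (ENNReal.rpow_le_rpow (hC₂ f g hf hfg) hb0))
  rw [lintegral_ofReal_norm_rpow_eq _ _ (by linarith : 0 < p)] at key2
  set Φ := eLpNorm f (ENNReal.ofReal p) volume
  have key3 := ENNReal.rpow_le_rpow key2 (inv_nonneg.2 hq0.le)
  rw [← ENNReal.rpow_mul, mul_inv_cancel₀ hq0.ne', ENNReal.rpow_one] at key3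
  refine key3.trans (le_of_eq ?_)
  have hp1' : 0 ≤ (p - 1)⁻¹ := inv_nonneg.2 hp0.le
  rw [ENNReal.mul_rpow_of_nonneg _ _ (inv_nonneg.2 hq0.le), ← ENNReal.rpow_mul, ← ENNReal.rpow_mul,
    ← ENNReal.rpow_mul, ENNReal.mul_rpow_of_nonneg _ _ (by positivity),
    ENNReal.mul_rpow_of_nonneg _ _ (by positivity), ← ENNReal.rpow_mul, ← ENNReal.rpow_mul,
    mul_mul_mul_comm, ← ENNReal.rpow_add_of_nonneg _ _ (by positivity) (by positivity)]
  -- Homogeneity: the powers of `‖f‖_p` from the two endpoints add up to one.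
  have hexp : p * (a * q⁻¹) + p * ((p - 1)⁻¹ * (b * q⁻¹)) = 1 := by
    have : p * a + p * ((p - 1)⁻¹ * b) = q := by
      rw [← hq, hr]
      ring
    calc _ = (p * a + p * ((p - 1)⁻¹ * b)) * q⁻¹ := by ring
      _ = 1 := by rw [this, mul_inv_cancel₀ hq0.ne']
  rw [hexp, ENNReal.rpow_one, div_eq_mul_inv, div_eq_mul_inv, mul_assoc (p - 1)⁻¹]

/-! ### Averages as Fourier multipliers. -/

theorem lintegral_enorm_mul_le_eLpNorm_mul_eLpNorm {X : Type*} [MeasurableSpace X] {m : Measure X}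
    {p q : ℝ≥0∞} [hpq : p.HolderConjugate q] {u v : X → ℂ} (hu : AEStronglyMeasurable u m)
    (hv : AEStronglyMeasurable v m) :
    ∫⁻ x, ‖u x * v x‖ₑ ∂m ≤ eLpNorm u p m * eLpNorm v q m := by
  have h : eLpNorm (u • v) 1 m ≤ eLpNorm u p m * eLpNorm v q m :=
    eLpNorm_smul_le_mul_eLpNorm hv hu
  rwa [eLpNorm_one_eq_lintegral_enorm] at h

/-- Every derivative has modulus `1`. This keeps modulations of Schwartz functions in the Schwartz
class. -/
theorem hasTemperateGrowth_cexp_neg_I_mul :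
    (fun r : ℝ => Complex.exp (-(Complex.I * (r : ℂ)))).HasTemperateGrowth := by
  have hder : ∀ k : ℕ, iteratedDeriv k (fun r : ℝ => Complex.exp (-(Complex.I * (r : ℂ)))) =
      fun r : ℝ => (-Complex.I) ^ k * Complex.exp (-(Complex.I * (r : ℂ))) := fun k => by
    induction k with
    | zero => simp
    | succ k ih =>
      rw [iteratedDeriv_succ, ih]
      funext r
      have h1 : HasDerivAt (fun r : ℝ => -(Complex.I * (r : ℂ))) (-Complex.I) r := by
        have h2 := ((Complex.ofRealCLM.hasDerivAt (x := r)).const_mul (-Complex.I))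
        simp only [Complex.ofRealCLM_apply, Complex.ofReal_one, mul_one, neg_mul] at h2
        exact h2
      rw [(h1.cexp.const_mul _).deriv, pow_succ]
      ring
  have hsm : ContDiff ℝ (⊤ : ℕ∞) fun r : ℝ => Complex.exp (-(Complex.I * (r : ℂ))) :=
    (contDiff_const.mul Complex.ofRealCLM.contDiff).neg.cexp
  refine ⟨hsm, fun k => ⟨0, 1, fun r => ?_⟩⟩
  rw [norm_iteratedFDeriv_eq_norm_iteratedDeriv, hder, norm_mul, norm_pow, norm_neg,
    Complex.norm_I, Complex.norm_exp]
  simp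

/-- The modulation `ξ ↦ e^{-i a·ξ} φ(ξ)` of a Schwartz function. -/
noncomputable def SchwartzMap.modulate (a : EuclideanSpace ℝ (Fin n))
    (φ : 𝓢(EuclideanSpace ℝ (Fin n), ℂ)) : 𝓢(EuclideanSpace ℝ (Fin n), ℂ) :=
  SchwartzMap.smulLeftCLM ℂ (fun ξ => fourierKernel a ξ) φ

theorem SchwartzMap.modulate_apply (a : EuclideanSpace ℝ (Fin n))
    (φ : 𝓢(EuclideanSpace ℝ (Fin n), ℂ)) (ξ : EuclideanSpace ℝ (Fin n)) :
    φ.modulate a ξ = fourierKernel a ξ * φ ξ :=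
  SchwartzMap.smulLeftCLM_apply_apply
    (hasTemperateGrowth_cexp_neg_I_mul.comp (Function.hasTemperateGrowth_inner_right a)) φ ξ

theorem schwartzFourier_modulate (a x : EuclideanSpace ℝ (Fin n))
    (φ : 𝓢(EuclideanSpace ℝ (Fin n), ℂ)) :
    schwartzFourier (φ.modulate a) x = schwartzFourier φ (x + a) := by
  simp only [schwartzFourier, SchwartzMap.modulate_apply, fourierKernel_add_left, mul_assoc]

/-- Move the translation onto `φ̂`; a translate of `φ̂` is the transform of a modulation of `φ`. -/
theorem IsFourierTransform.integral_translate_mul {f g : EuclideanSpace ℝ (Fin n) → ℂ}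
    (hfg : IsFourierTransform f g) (a : EuclideanSpace ℝ (Fin n))
    (φ : 𝓢(EuclideanSpace ℝ (Fin n), ℂ)) :
    ∫ x, f (x - a) * schwartzFourier φ x = ∫ ξ, g ξ * (fourierKernel a ξ * φ ξ) := by
  rw [← integral_add_right_eq_self (fun x => f (x - a) * schwartzFourier φ x) a]
  simp only [add_sub_cancel_right, ← schwartzFourier_modulate, ← SchwartzMap.modulate_apply]
  exact (hfg.pairing_eq _).symm

/-- Needed because `f` is only almost everywhere measurable: null sets must pull back to null sets
for `f(x - ty)` to be measurable on the product. -/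
theorem quasiMeasurePreserving_sub_smul (ρ : Measure (EuclideanSpace ℝ (Fin n))) [SFinite ρ]
    (t : ℝ) : Measure.QuasiMeasurePreserving
      (fun z : EuclideanSpace ℝ (Fin n) × EuclideanSpace ℝ (Fin n) => z.1 - t • z.2)
      (volume.prod ρ) volume := by
  have hm : Measurable
      (fun z : EuclideanSpace ℝ (Fin n) × EuclideanSpace ℝ (Fin n) => z.1 - t • z.2) := by fun_prop
  refine ⟨hm, Measure.AbsolutelyContinuous.mk fun s hs h0 => ?_⟩
  rw [Measure.map_apply hm hs, Measure.prod_apply_symm (hm hs)]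
  refine (lintegral_congr fun y => ?_).trans lintegral_zero
  have : (fun x => (x, y)) ⁻¹' ((fun z : EuclideanSpace ℝ (Fin n) × EuclideanSpace ℝ (Fin n) =>
      z.1 - t • z.2) ⁻¹' s) = (fun x => x - t • y) ⁻¹' s := rfl
  rw [this, (measurePreserving_sub_right volume (t • y)).measure_preimage hs.nullMeasurableSet, h0]

section Averages

variable {ρ : Measure (EuclideanSpace ℝ (Fin n))} [IsFiniteMeasure ρ]
  {h : EuclideanSpace ℝ (Fin n) → ℂ}

/-- Hölder in `y` against the finite measure `ρ`, then Tonelli and translation invariance in `x`. -/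
theorem MeasureTheory.MemLp.integral_translate_mul {p : ℝ} (hp : 1 ≤ p)
    {f : EuclideanSpace ℝ (Fin n) → ℂ} (hf : MemLp f (ENNReal.ofReal p) volume)
    (hh : Measurable h) (hh1 : ∀ y, ‖h y‖ = 1) (t : ℝ) :
    MemLp (fun x => ∫ y, f (x - t • y) * h y ∂ρ) (ENNReal.ofReal p) volume := by
  have hp0 : 0 < p := by linarith
  have hfm : AEStronglyMeasurable
      (fun z : EuclideanSpace ℝ (Fin n) × EuclideanSpace ℝ (Fin n) => f (z.1 - t • z.2))
      (volume.prod ρ) := hf.1.comp_quasiMeasurePreserving (quasiMeasurePreserving_sub_smul ρ t)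
  have hfhm : AEStronglyMeasurable
      (fun z : EuclideanSpace ℝ (Fin n) × EuclideanSpace ℝ (Fin n) => f (z.1 - t • z.2) * h z.2)
      (volume.prod ρ) := hfm.mul (hh.comp measurable_snd).aestronglyMeasurable
  refine ⟨hfhm.integral_prod_right', ?_⟩
  rw [eLpNorm_lt_top_iff_lintegral_rpow_enorm_lt_top (by simpa using hp0) ENNReal.ofReal_ne_top,
    ENNReal.toReal_ofReal hp0.le]
  have hpt : ∀ᵐ x, ‖∫ y, f (x - t • y) * h y ∂ρ‖ₑ ^ p ≤
      ρ Set.univ ^ (p - 1) * ∫⁻ y, ‖f (x - t • y)‖ₑ ^ p ∂ρ := by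
    filter_upwards [hfm.prodMk_left] with x hx
    have h1 : ‖∫ y, f (x - t • y) * h y ∂ρ‖ₑ ≤ eLpNorm (fun y => f (x - t • y)) 1 ρ := by
      rw [eLpNorm_one_eq_lintegral_enorm]
      refine (enorm_integral_le_lintegral_enorm _).trans (lintegral_mono fun y => ?_)
      rw [enorm_mul, ← ofReal_norm (h y), hh1]
      simp
    have h2 := h1.trans (eLpNorm_le_eLpNorm_mul_rpow_measure_univ
      (q := ENNReal.ofReal p) (by simpa using hp) hx)
    refine (ENNReal.rpow_le_rpow h2 hp0.le).trans (le_of_eq ?_)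
    rw [ENNReal.mul_rpow_of_nonneg _ _ hp0.le, eLpNorm_eq_lintegral_rpow_enorm_toReal
      (by simpa using hp0) ENNReal.ofReal_ne_top, ENNReal.toReal_ofReal hp0.le,
      ← ENNReal.rpow_mul, ← ENNReal.rpow_mul, one_div_mul_cancel hp0.ne', ENNReal.rpow_one,
      mul_comm]
    congr 2
    rw [ENNReal.toReal_one]
    field_simp
  refine (lintegral_mono_ae hpt).trans_lt ?_
  have hsw : ∫⁻ x, ∫⁻ y, ‖f (x - t • y)‖ₑ ^ p ∂ρ = (∫⁻ x, ‖f x‖ₑ ^ p) * ρ Set.univ := by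
    rw [lintegral_lintegral_swap (hfm.enorm.pow_const p)]
    simp only [lintegral_sub_right_eq_self (fun x => ‖f x‖ₑ ^ p), lintegral_const]
  have hfin : ∫⁻ x, ‖f x‖ₑ ^ p < ∞ := by
    have := (eLpNorm_lt_top_iff_lintegral_rpow_enorm_lt_top (by simpa using hp0)
      ENNReal.ofReal_ne_top).1 hf.2
    rwa [ENNReal.toReal_ofReal hp0.le] at this
  have hρ : ρ Set.univ ^ (p - 1) ≠ ∞ :=
    ENNReal.rpow_ne_top_of_nonneg (by linarith) (measure_ne_top _ _)
  rw [lintegral_const_mul' _ _ hρ, hsw]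
  exact ENNReal.mul_lt_top hρ.lt_top (ENNReal.mul_lt_top hfin (measure_lt_top _ _))

theorem continuous_integral_fourierKernel_mul (hh : Measurable h) (hh1 : ∀ y, ‖h y‖ = 1) :
    Continuous fun ξ => ∫ y, fourierKernel y ξ * h y ∂ρ := by
  have hhi : Integrable h ρ := Integrable.of_bound hh.aestronglyMeasurable 1
    (Filter.Eventually.of_forall fun y => (hh1 y).le)
  refine continuous_of_dominated (bound := fun y => ‖h y‖) (fun ξ => (hhi.fourierKernel_mul ξ).1)
    (fun ξ => Filter.Eventually.of_forall fun y => ?_) hhi.norm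
    (Filter.Eventually.of_forall fun y => by fun_prop)
  rw [norm_mul, norm_fourierKernel, one_mul]

theorem norm_integral_fourierKernel_mul_le (hh1 : ∀ y, ‖h y‖ = 1)
    (ξ : EuclideanSpace ℝ (Fin n)) :
    ‖∫ y, fourierKernel y ξ * h y ∂ρ‖ ≤ ρ.real Set.univ := by
  refine (norm_integral_le_of_norm_le_const (C := 1)
    (Filter.Eventually.of_forall fun y => ?_)).trans (by rw [one_mul])
  rw [norm_mul, norm_fourierKernel, hh1, one_mul]

theorem IsFourierTransform.integral_translate {p : ℝ} (hp : 1 ≤ p)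
    {f g : EuclideanSpace ℝ (Fin n) → ℂ} (hf : MemLp f (ENNReal.ofReal p) volume)
    (hfg : IsFourierTransform f g) (hh : Measurable h) (hh1 : ∀ y, ‖h y‖ = 1) (t : ℝ) :
    IsFourierTransform (fun x => ∫ y, f (x - t • y) * h y ∂ρ)
      (fun ξ => (∫ y, fourierKernel y (t • ξ) * h y ∂ρ) * g ξ) := by
  have hp1 : 1 ≤ ENNReal.ofReal p := by simpa using hp
  have hhi : Integrable h ρ := Integrable.of_bound hh.aestronglyMeasurable 1
    (Filter.Eventually.of_forall fun y => (hh1 y).le)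
  have hcont : Continuous fun ξ : EuclideanSpace ℝ (Fin n) =>
      ∫ y, fourierKernel y (t • ξ) * h y ∂ρ :=
    (continuous_integral_fourierKernel_mul hh hh1).comp (continuous_const_smul t)
  refine ⟨hcont.aestronglyMeasurable.mul hfg.aestronglyMeasurable, fun φ => ?_, fun φ => ?_⟩
  · simp only [mul_assoc]
    exact (hfg.integrable_mul φ).bdd_mul hcont.aestronglyMeasurable
      (Filter.Eventually.of_forall fun ξ => norm_integral_fourierKernel_mul_le hh1 _)
  have hfm : AEStronglyMeasurable
      (fun z : EuclideanSpace ℝ (Fin n) × EuclideanSpace ℝ (Fin n) => f (z.1 - t • z.2))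
      (volume.prod ρ) := hf.1.comp_quasiMeasurePreserving (quasiMeasurePreserving_sub_smul ρ t)
  have hφm : AEStronglyMeasurable
      (fun z : EuclideanSpace ℝ (Fin n) × EuclideanSpace ℝ (Fin n) => schwartzFourier φ z.1)
      (volume.prod ρ) := by
    rw [← coe_schwartzFourierMap]
    exact ((schwartzFourierMap φ).continuous.comp continuous_fst).aestronglyMeasurable
  have htrans : ∀ a : EuclideanSpace ℝ (Fin n),
      MemLp (fun x => f (x - a)) (ENNReal.ofReal p) volume := fun a =>
    hf.comp_measurePreserving (measurePreserving_sub_right volume a)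
  -- Hölder in `x` gives a bound independent of `y`, and `ρ` is finite; this justifies Fubini.
  have hint₁ : Integrable
      (fun z : EuclideanSpace ℝ (Fin n) × EuclideanSpace ℝ (Fin n) =>
        f (z.1 - t • z.2) * schwartzFourier φ z.1 * h z.2) (volume.prod ρ) := by
    have hm : AEStronglyMeasurable
      (fun z : EuclideanSpace ℝ (Fin n) × EuclideanSpace ℝ (Fin n) =>
        f (z.1 - t • z.2) * schwartzFourier φ z.1) (volume.prod ρ) := hfm.mul hφm
    have : Integrable (fun z : EuclideanSpace ℝ (Fin n) × EuclideanSpace ℝ (Fin n) =>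
        f (z.1 - t • z.2) * schwartzFourier φ z.1) (volume.prod ρ) := by
      have hconj := ENNReal.HolderConjugate.conjExponent hp1
      have hSm := (schwartzFourierMap φ).memLp (ENNReal.ofReal p).conjExponent volume
      refine ⟨hm, ?_⟩
      rw [hasFiniteIntegral_iff_enorm, lintegral_prod_symm _ hm.enorm]
      have hle : ∀ y, ∫⁻ x, ‖f (x - t • y) * schwartzFourier φ x‖ₑ ≤
          eLpNorm f (ENNReal.ofReal p) volume *
            eLpNorm (schwartzFourierMap φ) (ENNReal.ofReal p).conjExponent volume := fun y => by
        have he : eLpNorm (fun x => f (x - t • y)) (ENNReal.ofReal p) volume =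
            eLpNorm f (ENNReal.ofReal p) volume :=
          eLpNorm_comp_measurePreserving hf.1 (measurePreserving_sub_right volume (t • y))
        rw [← he, ← coe_schwartzFourierMap]
        exact lintegral_enorm_mul_le_eLpNorm_mul_eLpNorm (htrans (t • y)).1 hSm.1
      refine (lintegral_mono hle).trans_lt ?_
      rw [lintegral_const]
      exact ENNReal.mul_lt_top (ENNReal.mul_lt_top hf.2 hSm.2) (measure_lt_top _ _)
    exact this.mul_bdd (c := 1) (hh.comp measurable_snd).aestronglyMeasurable
      (Filter.Eventually.of_forall fun z => (hh1 _).le)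
  have hint₂ : Integrable
      (fun z : EuclideanSpace ℝ (Fin n) × EuclideanSpace ℝ (Fin n) =>
        g z.1 * (fourierKernel (t • z.2) z.1 * φ z.1) * h z.2) (volume.prod ρ) := by
    have h1 : Integrable (fun z : EuclideanSpace ℝ (Fin n) × EuclideanSpace ℝ (Fin n) =>
      (g z.1 * φ z.1) * h z.2) (volume.prod ρ) := (hfg.integrable_mul φ).mul_prod hhi
    refine (h1.bdd_mul (c := 1) (f := fun z => fourierKernel (t • z.2) z.1)
      (Continuous.aestronglyMeasurable (by fun_prop))
      (Filter.Eventually.of_forall fun z => (norm_fourierKernel _ _).le)).congr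
      (Filter.Eventually.of_forall fun z => by simp only; ring)
  calc ∫ ξ, (∫ y, fourierKernel y (t • ξ) * h y ∂ρ) * g ξ * φ ξ
      = ∫ ξ, ∫ y, g ξ * (fourierKernel (t • y) ξ * φ ξ) * h y ∂ρ := by
        refine integral_congr_ae (Filter.Eventually.of_forall fun ξ => ?_)
        simp only [mul_assoc, fourierKernel_smul_left]
        rw [← integral_mul_const]
        refine integral_congr_ae (Filter.Eventually.of_forall fun y => ?_)
        simp only
        ring
    _ = ∫ y, (∫ x, f (x - t • y) * schwartzFourier φ x * h y) ∂ρ := by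
        rw [integral_integral_swap hint₂]
        refine integral_congr_ae (Filter.Eventually.of_forall fun y => ?_)
        simp only [integral_mul_const, hfg.integral_translate_mul]
    _ = ∫ x, (∫ y, f (x - t • y) * h y ∂ρ) * schwartzFourier φ x := by
        refine (integral_integral_swap (f := fun x y =>
          f (x - t • y) * schwartzFourier φ x * h y) hint₁).symm.trans ?_
        refine integral_congr_ae (Filter.Eventually.of_forall fun x => ?_)
        simp only [← integral_mul_const]
        refine integral_congr_ae (Filter.Eventually.of_forall fun y => ?_)
        simp only
        ring

end Averages

theorem MeasureTheory.MemLp.averageOp_sub {p : ℝ} (hp : 1 ≤ p)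
    {f : EuclideanSpace ℝ (Fin n) → ℂ} (hf : MemLp f (ENNReal.ofReal p) volume)
    (μ : ComplexMeasure (EuclideanSpace ℝ (Fin n))) (t : ℝ) :
    MemLp (fun x => averageOp μ t f x - f x) (ENNReal.ofReal p) volume := by
  have := ComplexMeasure.isFiniteMeasure_variation μ
  obtain ⟨h, hh, hh1, hμ⟩ := ComplexMeasure.exists_unimodular_density μ
  simp only [averageOp, hμ]
  exact (hf.integral_translate_mul hp hh hh1 t).sub hf

/-- Averaging acts on the Fourier side as multiplication by `μ̂(t ξ)`. -/
theorem IsFourierTransform.averageOp_sub {p : ℝ} (hp : 1 ≤ p)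
    {f g : EuclideanSpace ℝ (Fin n) → ℂ} (hf : MemLp f (ENNReal.ofReal p) volume)
    (hfg : IsFourierTransform f g) (μ : ComplexMeasure (EuclideanSpace ℝ (Fin n))) (t : ℝ) :
    IsFourierTransform (fun x => averageOp μ t f x - f x)
      (fun ξ => (measureFourier μ (t • ξ) - 1) * g ξ) := by
  have := ComplexMeasure.isFiniteMeasure_variation μ
  obtain ⟨h, hh, hh1, hμ⟩ := ComplexMeasure.exists_unimodular_density μ
  have hp1 : 1 ≤ ENNReal.ofReal p := by simpa using hp
  have hneg : IsFourierTransform (fun x => -f x) (fun ξ => -g ξ) :=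
    ⟨hfg.aestronglyMeasurable.neg, fun φ => by
        simp only [neg_mul]
        exact (hfg.integrable_mul φ).neg,
      fun φ => by simp only [neg_mul, integral_neg, hfg.pairing_eq]⟩
  have key := (hfg.integral_translate hp hf hh hh1 t (ρ := μ.variation)).add hp1 hp1
    (hf.integral_translate_mul hp hh hh1 t) hf.neg hneg
  simp only [averageOp, measureFourier, hμ, sub_mul, one_mul]
  simp only [Pi.neg_apply, ← sub_eq_add_neg] at key
  exact key

/-! ### Duality. -/

/-- Converse of Hölder's inequality, tested on Schwartz functions. -/
theorem eLpNorm_le_of_forall_schwartz {p p' : ℝ} (hpp : p.HolderConjugate p')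
    {F : EuclideanSpace ℝ (Fin n) → ℂ} (hF : MemLp F (ENNReal.ofReal p) volume) {K : ℝ≥0∞}
    (H : ∀ ψ : 𝓢(EuclideanSpace ℝ (Fin n), ℂ),
      ‖∫ x, F x * ψ x‖ₑ ≤ K * eLpNorm ψ (ENNReal.ofReal p') volume) :
    eLpNorm F (ENNReal.ofReal p) volume ≤ K := by
  rcases eq_or_ne K ∞ with rfl | hK
  · exact le_top
  have hp0 := hpp.pos
  have hp0' := hpp.symm.pos
  have hp1 := hpp.lt
  have hconj : (ENNReal.ofReal p).HolderConjugate (ENNReal.ofReal p') := hpp.ennrealOfReal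
  set Φ := eLpNorm F (ENNReal.ofReal p) volume with hΦ
  have hΦtop : Φ ≠ ∞ := hF.2.ne
  rcases eq_or_ne Φ 0 with hΦ0 | hΦ0
  · rw [hΦ0]
    exact zero_le
  -- The extremizer in Hölder's inequality: `F h = |F|^p` and `|h|^{p'} = |F|^p`.
  let h : EuclideanSpace ℝ (Fin n) → ℂ := fun x =>
    (starRingEnd ℂ) (F x) * ((‖F x‖ ^ (p - 2) : ℝ) : ℂ)
  have hhm : AEStronglyMeasurable h volume := by
    have h1 : AEStronglyMeasurable (fun x => (starRingEnd ℂ) (F x)) volume :=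
      RCLike.continuous_conj.comp_aestronglyMeasurable hF.1
    have h2 : AEMeasurable (fun x => ((‖F x‖ ^ (p - 2) : ℝ) : ℂ)) volume := by
      have := hF.1.norm.aemeasurable
      fun_prop
    exact h1.mul h2.aestronglyMeasurable
  have hhn : ∀ x, ‖h x‖ = ‖F x‖ ^ (p - 1) := fun x => by
    simp only [h]
    rw [norm_mul, RCLike.norm_conj, Complex.norm_real, Real.norm_of_nonneg (by positivity),
      mul_comm, ← Real.rpow_add_one' (norm_nonneg _) (by linarith)]
    congr 1
    ring
  have hhF : eLpNorm h (ENNReal.ofReal p') volume = Φ ^ (p - 1) := by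
    have h1 : eLpNorm h (ENNReal.ofReal p') volume ^ p' = Φ ^ p := by
      rw [hΦ, ← lintegral_ofReal_norm_rpow_eq _ _ hp0', ← lintegral_ofReal_norm_rpow_eq _ _ hp0]
      refine lintegral_congr fun x => ?_
      rw [hhn, ← Real.rpow_mul (norm_nonneg _), hpp.sub_one_mul_conj]
    calc eLpNorm h (ENNReal.ofReal p') volume
        = (eLpNorm h (ENNReal.ofReal p') volume ^ p') ^ p'⁻¹ := by
          rw [← ENNReal.rpow_mul, mul_inv_cancel₀ hp0'.ne', ENNReal.rpow_one]
      _ = Φ ^ (p - 1) := by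
          rw [h1, ← ENNReal.rpow_mul]
          congr 1
          rw [← div_eq_mul_inv, div_eq_iff hp0'.ne', hpp.sub_one_mul_conj]
  have hhL : MemLp h (ENNReal.ofReal p') volume := ⟨hhm, by
    rw [hhF]
    exact ENNReal.rpow_lt_top_of_nonneg (by linarith) hΦtop⟩
  have hFh : ‖∫ x, F x * h x‖ₑ = Φ ^ p := by
    have h1 : ∀ x, F x * h x = ((‖F x‖ ^ p : ℝ) : ℂ) := fun x => by
      simp only [h]
      rw [← mul_assoc, Complex.mul_conj, Complex.normSq_eq_norm_sq, ← Complex.ofReal_mul]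
      congr 1
      rcases (norm_nonneg (F x)).eq_or_lt with h0 | h0
      · rw [← h0, Real.zero_rpow hp0.ne']
        ring
      · rw [← Real.rpow_two, ← Real.rpow_add h0]
        congr 1
        ring
    simp only [h1]
    rw [integral_complex_ofReal, ← ofReal_norm, Complex.norm_real, Real.norm_of_nonneg
      (integral_nonneg fun x => by positivity), ofReal_integral_eq_lintegral_ofReal
      (hF.integrable_norm_rpow_ofReal hp0) (Filter.Eventually.of_forall fun x => by positivity),
      lintegral_ofReal_norm_rpow_eq _ _ hp0]
  have hmain : Φ ^ p ≤ K * Φ ^ (p - 1) := by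
    refine ENNReal.le_of_forall_pos_le_add fun ε hε _ => ?_
    -- Approximating `h` within `ε/c` costs `(K + Φ) ε/c ≤ ε`; the `1` keeps `c` positive.
    set c : ℝ := K.toReal + Φ.toReal + 1 with hc
    have hc0 : 0 < c := by positivity
    obtain ⟨u, huc, hus, hu⟩ := hhL.exist_eLpNorm_sub_le ENNReal.ofReal_ne_top
      (by simpa using hpp.symm.lt.le) (ε := ε / c) (by positivity)
    set ψ := huc.toSchwartzMap hus with hψ
    have hψu : ⇑ψ = u := rfl
    have hψL := ψ.memLp (ENNReal.ofReal p') volume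
    have e1 : ‖∫ x, F x * (h x - ψ x)‖ₑ ≤ Φ * ENNReal.ofReal (ε / c) :=
      (enorm_integral_le_lintegral_enorm _).trans
        ((lintegral_enorm_mul_le_eLpNorm_mul_eLpNorm hF.1 (hhL.sub hψL).1).trans
          (mul_le_mul_right hu _))
    have e2 : ‖∫ x, F x * ψ x‖ₑ ≤ K * (Φ ^ (p - 1) + ENNReal.ofReal (ε / c)) := by
      refine (H ψ).trans (mul_le_mul_right ?_ _)
      have : ⇑ψ = h + (u - h) := by rw [hψu]; abel
      rw [this]
      refine (eLpNorm_add_le hhm (hψL.sub hhL).1 (by simpa using hpp.symm.lt.le)).trans ?_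
      rw [hhF, eLpNorm_sub_comm]
      exact add_le_add le_rfl hu
    have e3 : ∫ x, F x * h x = (∫ x, F x * ψ x) + ∫ x, F x * (h x - ψ x) := by
      refine Eq.trans ?_ (integral_add (hF.integrable_mul hψL) (hF.integrable_mul (hhL.sub hψL)))
      refine integral_congr_ae (Filter.Eventually.of_forall fun x => ?_)
      change F x * h x = F x * ψ x + F x * (h x - ψ x)
      ring
    have e4 : K * ENNReal.ofReal (ε / c) + Φ * ENNReal.ofReal (ε / c) ≤ ε := by
      rw [← add_mul, ← ENNReal.ofReal_toReal hK, ← ENNReal.ofReal_toReal hΦtop,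
        ← ENNReal.ofReal_add (by positivity) (by positivity), ← ENNReal.ofReal_mul (by positivity),
        ← ENNReal.ofReal_coe_nnreal]
      refine ENNReal.ofReal_le_ofReal ?_
      rw [mul_div_assoc', div_le_iff₀ hc0, mul_comm]
      have := ε.coe_nonneg
      gcongr
      rw [hc]
      linarith
    calc Φ ^ p ≤ ‖∫ x, F x * ψ x‖ₑ + ‖∫ x, F x * (h x - ψ x)‖ₑ := by
          rw [← hFh, e3]
          exact enorm_add_le _ _
      _ ≤ K * (Φ ^ (p - 1) + ENNReal.ofReal (ε / c)) + Φ * ENNReal.ofReal (ε / c) :=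
          add_le_add e2 e1
      _ = K * Φ ^ (p - 1) + (K * ENNReal.ofReal (ε / c) + Φ * ENNReal.ofReal (ε / c)) := by ring
      _ ≤ _ := by gcongr
  have hpow : Φ ^ p = Φ * Φ ^ (p - 1) := by
    conv_rhs => rw [← ENNReal.rpow_one Φ, ← ENNReal.rpow_mul, ← ENNReal.rpow_add _ _ hΦ0 hΦtop]
    congr 1
    ring
  rw [hpow] at hmain
  exact (ENNReal.mul_le_mul_iff_left (by simp [hΦ0, hΦtop])
    (ENNReal.rpow_ne_top_of_nonneg (by linarith) hΦtop)).1 hmain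

/-- Fourier inversion in this normalization; it exhibits every Schwartz function as a transform. -/
theorem schwartzFourier_schwartzFourierMap (χ : 𝓢(EuclideanSpace ℝ (Fin n), ℂ))
    (x : EuclideanSpace ℝ (Fin n)) :
    schwartzFourier (schwartzFourierMap χ) x = (((2 * Real.pi) ^ n : ℝ) : ℂ) * χ (-x) := by
  have hpi : 2 * Real.pi ≠ 0 := by positivity
  have h1 : χ (-x) = schwartzFourier (𝓕 χ) ((2 * Real.pi) • x) := by
    rw [schwartzFourier_eq, smul_smul, inv_mul_cancel₀ hpi, one_smul]
    conv_lhs => rw [← FourierTransform.fourierInv_fourier_eq (F := 𝓢(EuclideanSpace ℝ (Fin n), ℂ)) χ]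
    rw [SchwartzMap.fourierInv_coe, Real.fourierInv_eq_fourier_neg, neg_neg,
      SchwartzMap.fourier_coe (𝓕 χ)]
  rw [h1, schwartzFourier, schwartzFourier]
  have h2 := Measure.integral_comp_smul volume
    (fun η : EuclideanSpace ℝ (Fin n) => fourierKernel ((2 * Real.pi) • x) η * (𝓕 χ) η)
    (2 * Real.pi)⁻¹
  rw [finrank_euclideanSpace_fin, inv_pow, inv_inv, abs_of_nonneg (by positivity),
    Complex.real_smul] at h2
  rw [← h2]
  refine integral_congr_ae (Filter.Eventually.of_forall fun ξ => ?_)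
  simp only [fourierKernel_smul_left, smul_smul, mul_inv_cancel₀ hpi, one_smul]
  rfl

theorem conjExponent_conjExponent {p : ℝ} (hp : 1 < p) :
    Real.conjExponent (Real.conjExponent p) = p := by
  have h := (Real.HolderConjugate.conjExponent hp).symm
  exact h.conjugate_eq.symm

theorem conjExponent_le_conjExponent {p q : ℝ} (hp : 1 < p) (hpq : p ≤ q) :
    Real.conjExponent q ≤ Real.conjExponent p := by
  rw [Real.conjExponent, Real.conjExponent, div_le_div_iff₀ (by linarith) (by linarith)]
  linarith

/-- The dual form of Pitt's inequality. -/
theorem exists_eLpNorm_le_weighted (hn : 0 < n) {p q : ℝ} (hp : 2 ≤ p) (hq : 1 < q)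
    (hqp : max q (Real.conjExponent q) ≤ p) : ∃ C : ℝ≥0,
    ∀ F G : EuclideanSpace ℝ (Fin n) → ℂ,
      MemLp F (ENNReal.ofReal p) volume → IsFourierTransform F G →
        eLpNorm F (ENNReal.ofReal p) volume ≤
          C * eLpNorm (weighted p q G) (ENNReal.ofReal q) volume := by
  have hp1 : 1 < p := by linarith
  have hpp := Real.HolderConjugate.conjExponent hp1
  have hqq := Real.HolderConjugate.conjExponent hq
  set p' := Real.conjExponent p with hp'
  set q' := Real.conjExponent q with hq'
  have hp'2 : p' ≤ 2 := by
    rw [hp', Real.conjExponent, div_le_iff₀ (by linarith)]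
    linarith
  have : Nontrivial (EuclideanSpace ℝ (Fin n)) :=
    Module.nontrivial_of_finrank_pos (R := ℝ) (by rwa [finrank_euclideanSpace_fin])
  -- Pitt for the pair `(p', q')`: `q ≤ p` gives `p' ≤ q'`, and `q' ≤ p` is the upper bound `q' ≤
  -- (p')'`.
  obtain ⟨C, hC⟩ := exists_eLpNorm_weighted_le hn hpp.symm.lt hp'2
    (conjExponent_le_conjExponent hq ((le_max_left _ _).trans hqp))
    (by rw [hp', conjExponent_conjExponent hp1]; exact (le_max_right _ _).trans hqp)
  set c : ℂ := (((2 * Real.pi) ^ n : ℝ) : ℂ) with hc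
  have hc0 : c ≠ 0 := by
    rw [hc]
    exact_mod_cast (by positivity : (2 * Real.pi) ^ n ≠ 0)
  refine ⟨C * ‖c⁻¹‖₊, fun F G hF hFG => eLpNorm_le_of_forall_schwartz hpp hF fun ψ => ?_⟩
  -- The reflection and the factor `c⁻¹` undo the double transform, so that `φ = χ̂` satisfies `φ̂ =
  -- ψ`.
  set χ : 𝓢(EuclideanSpace ℝ (Fin n), ℂ) := c⁻¹ • ψ.dilate (-1) (by norm_num) with hχ
  set φ := schwartzFourierMap χ with hφ
  have hφψ : ∀ x, schwartzFourier φ x = ψ x := fun x => by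
    rw [hφ, schwartzFourier_schwartzFourierMap, hχ, smul_apply,
      SchwartzMap.dilate_apply, ← hc, smul_eq_mul, mul_inv_cancel_left₀ hc0, neg_smul, one_smul,
      neg_neg]
  have hχφ : IsFourierTransform χ φ := by
    have h1 := IsFourierTransform.of_integrable (χ.integrable (μ := volume))
    have h2 : ⇑φ = fun ξ => ∫ x, fourierKernel x ξ * χ x := by
      rw [hφ, coe_schwartzFourierMap]
      funext ξ
      simp only [schwartzFourier, fourierKernel_comm ξ]
    rwa [h2]
  have hχn : eLpNorm χ (ENNReal.ofReal p') volume =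
      ‖c⁻¹‖ₑ * eLpNorm ψ (ENNReal.ofReal p') volume := by
    have h1 : ⇑χ = c⁻¹ • (ψ ∘ Neg.neg) := by
      funext x
      rw [hχ, smul_apply, SchwartzMap.dilate_apply, neg_smul, one_smul]
      rfl
    rw [h1, eLpNorm_const_smul, eLpNorm_comp_measurePreserving ψ.continuous.aestronglyMeasurable
      (Measure.measurePreserving_neg volume)]
  have hpair : ∫ x, F x * ψ x = ∫ ξ, G ξ * φ ξ := by
    rw [hFG.pairing_eq φ]
    simp only [hφψ]
  have hconj : (ENNReal.ofReal q).HolderConjugate (ENNReal.ofReal q') := hqq.ennrealOfReal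
  -- The dual weight is the reciprocal one, so inserting both leaves `G φ` unchanged away from `ξ =
  -- 0`.
  have hexp : (n : ℝ) * (1 - 1 / p' - 1 / q') = -((n : ℝ) * (1 - 1 / p - 1 / q)) := by
    have h1 := hpp.inv_add_inv_eq_one
    have h2 := hqq.inv_add_inv_eq_one
    simp only [one_div]
    linear_combination (n : ℝ) * (-h1 - h2)
  calc ‖∫ x, F x * ψ x‖ₑ ≤ ∫⁻ ξ, ‖G ξ * φ ξ‖ₑ := by
        rw [hpair]
        exact enorm_integral_le_lintegral_enorm _
    _ = ∫⁻ ξ, ‖weighted p q G ξ * weighted p' q' φ ξ‖ₑ := by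
        have h0 : ∀ᵐ ξ : EuclideanSpace ℝ (Fin n), ξ ≠ 0 := by
          simp [ae_iff]
        refine lintegral_congr_ae (h0.mono fun ξ hξ => ?_)
        simp only
        rw [weighted, weighted, hexp, mul_mul_mul_comm, ← Complex.ofReal_mul,
          ← Real.rpow_add (norm_pos_iff.2 hξ), add_neg_cancel, Real.rpow_zero, Complex.ofReal_one,
          one_mul]
    _ ≤ eLpNorm (weighted p q G) (ENNReal.ofReal q) volume *
          eLpNorm (weighted p' q' φ) (ENNReal.ofReal q') volume :=
        lintegral_enorm_mul_le_eLpNorm_mul_eLpNorm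
          (aestronglyMeasurable_weighted hFG.aestronglyMeasurable)
          (aestronglyMeasurable_weighted hχφ.aestronglyMeasurable)
    _ ≤ eLpNorm (weighted p q G) (ENNReal.ofReal q) volume *
          (C * (‖c⁻¹‖ₑ * eLpNorm ψ (ENNReal.ofReal p') volume)) := by
        rw [← hχn]
        exact mul_le_mul_right (hC _ _ (χ.memLp _ volume) hχφ) _
    _ = _ := by
        rw [ENNReal.coe_mul, enorm_eq_nnnorm]
        ring

/-! ### Assembly of the two inequalities. -/

theorem weightedFourierNorm_eq_eLpNorm {σ p q t : ℝ} (hq : 0 < q) (ht : 0 ≤ t)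
    (g : EuclideanSpace ℝ (Fin n) → ℂ) : weightedFourierNorm σ p q t g =
      eLpNorm (fun ξ => ((min 1 ((t * ‖ξ‖) ^ (2 * σ)) : ℝ) : ℂ) * weighted p q g ξ)
        (ENNReal.ofReal q) volume := by
  rw [eLpNorm_eq_lintegral_rpow_enorm_toReal (by simpa using hq) ENNReal.ofReal_ne_top,
    ENNReal.toReal_ofReal hq.le, weightedFourierNorm]
  congr 1
  refine lintegral_congr fun ξ => ?_
  have h0 : 0 ≤ t * ‖ξ‖ := by positivity
  have hm : min 1 ((t * ‖ξ‖) ^ (2 * σ * q)) = min 1 ((t * ‖ξ‖) ^ (2 * σ)) ^ q := by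
    rw [Real.rpow_mul h0]
    rcases le_total 1 ((t * ‖ξ‖) ^ (2 * σ)) with h | h
    · rw [min_eq_left h, min_eq_left (Real.one_le_rpow h hq.le), Real.one_rpow]
    · rw [min_eq_right h, min_eq_right (Real.rpow_le_one (by positivity) h hq.le)]
  have hmin : 0 ≤ min 1 ((t * ‖ξ‖) ^ (2 * σ)) := by positivity
  rw [← ofReal_norm, ENNReal.ofReal_rpow_of_nonneg (norm_nonneg _) hq.le, weighted, norm_mul,
    norm_mul, Complex.norm_real, Complex.norm_real, Real.norm_of_nonneg hmin,
    Real.norm_of_nonneg (by positivity), hm, Real.mul_rpow hmin (by positivity),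
    Real.mul_rpow (Real.rpow_nonneg (norm_nonneg ξ) _) (norm_nonneg (g ξ)),
    ← Real.rpow_mul (norm_nonneg ξ), mul_assoc]
  congr 4
  ring

theorem norm_weighted_mul {p q : ℝ} (m g : EuclideanSpace ℝ (Fin n) → ℂ)
    (ξ : EuclideanSpace ℝ (Fin n)) :
    ‖weighted p q (fun ξ => m ξ * g ξ) ξ‖ = ‖m ξ‖ * ‖weighted p q g ξ‖ := by
  simp only [weighted, norm_mul]
  ring

theorem mainTheorem4 (n : ℕ) (hn : 2 ≤ n) (σ : ℝ)
    (μ : ComplexMeasure (EuclideanSpace ℝ (Fin n))) (hμ : InClassK σ μ) :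
    (∀ p q : ℝ, 1 < p → p ≤ 2 → p ≤ q → q ≤ Real.conjExponent p →
      ∃ c : ℝ, 0 < c ∧ ∀ f : EuclideanSpace ℝ (Fin n) → ℂ,
        MemLp f (ENNReal.ofReal p) volume →
          (∃ g, IsFourierTransform f g) ∧
          ∀ g, IsFourierTransform f g →
            MemLp (weighted p q g) (ENNReal.ofReal q) volume ∧
            ∀ t : ℝ, 0 < t →
              weightedFourierNorm σ p q t g ≤
                ENNReal.ofReal c *
                  eLpNorm (fun x => averageOp μ t f x - f x) (ENNReal.ofReal p) volume) ∧
    (∀ p q : ℝ, 2 ≤ p → 1 < q → max q (Real.conjExponent q) ≤ p →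
      ∃ c : ℝ, 0 < c ∧ ∀ f g : EuclideanSpace ℝ (Fin n) → ℂ,
        MemLp f (ENNReal.ofReal p) volume → IsFourierTransform f g →
          MemLp (weighted p q g) (ENNReal.ofReal q) volume →
            ∀ t : ℝ, 0 < t →
              eLpNorm (fun x => averageOp μ t f x - f x) (ENNReal.ofReal p) volume ≤
                ENNReal.ofReal c * weightedFourierNorm σ p q t g) := by
  have hn0 : 0 < n := by omega
  obtain ⟨A, B, hA, hB, hAB⟩ := hμ.comparable
  have hnorm : ∀ t : ℝ, 0 < t → ∀ ξ : EuclideanSpace ℝ (Fin n),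
      A * min 1 ((t * ‖ξ‖) ^ (2 * σ)) ≤ ‖measureFourier μ (t • ξ) - 1‖ ∧
        ‖measureFourier μ (t • ξ) - 1‖ ≤ B * min 1 ((t * ‖ξ‖) ^ (2 * σ)) := fun t ht ξ => by
    have := hAB (t • ξ)
    rwa [norm_smul, Real.norm_of_nonneg ht.le, norm_sub_rev] at this
  have hmin : ∀ t : ℝ, 0 < t → ∀ ξ : EuclideanSpace ℝ (Fin n),
      ‖((min 1 ((t * ‖ξ‖) ^ (2 * σ)) : ℝ) : ℂ)‖ = min 1 ((t * ‖ξ‖) ^ (2 * σ)) := fun t ht ξ => by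
    rw [Complex.norm_real, Real.norm_of_nonneg (by positivity)]
  refine ⟨fun p q hp1 hp2 hpq hqp => ?_, fun p q hp hq hqp => ?_⟩
  · obtain ⟨C, hC⟩ := exists_eLpNorm_weighted_le hn0 hp1 hp2 hpq hqp
    -- `A⁻¹` comes from the lower bound on the multiplier; `C + 1` replaces `C`, which may vanish,
    -- to keep the constant positive.
    refine ⟨A⁻¹ * (C + 1), by positivity, fun f hf =>
      ⟨exists_isFourierTransform_of_memLp hp1.le hp2 hf, fun g hfg => ⟨⟨?_, ?_⟩, fun t ht => ?_⟩⟩⟩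
    · exact aestronglyMeasurable_weighted hfg.aestronglyMeasurable
    · exact (hC f g hf hfg).trans_lt (ENNReal.mul_lt_top ENNReal.coe_lt_top hf.2)
    · rw [weightedFourierNorm_eq_eLpNorm (by linarith) ht.le]
      -- Pitt's inequality is applied to `M_μ^t f - f`, whose transform carries the multiplier.
      have h1 := hC _ _ (hf.averageOp_sub hp1.le μ t) (hfg.averageOp_sub hp1.le hf μ t)
      refine (eLpNorm_le_mul_eLpNorm_of_ae_le_mul (c := A⁻¹) (g := weighted p q
        (fun ξ => (measureFourier μ (t • ξ) - 1) * g ξ))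
        (Filter.Eventually.of_forall fun ξ => ?_) _).trans ?_
      · rw [norm_weighted_mul, norm_mul, hmin t ht, ← mul_assoc]
        refine mul_le_mul_of_nonneg_right ?_ (norm_nonneg _)
        rw [le_inv_mul_iff₀ hA]
        exact (hnorm t ht ξ).1
      · rw [ENNReal.ofReal_mul (by positivity), mul_assoc]
        refine mul_le_mul_right (h1.trans (mul_le_mul_left ?_ _)) _
        rw [← ENNReal.ofReal_coe_nnreal]
        exact ENNReal.ofReal_le_ofReal (by linarith)
  · obtain ⟨C, hC⟩ := exists_eLpNorm_le_weighted hn0 hp hq hqp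
    have hp1 : 1 ≤ p := by linarith
    refine ⟨(C + 1) * B, by positivity, fun f g hf hfg _ t ht => ?_⟩
    rw [weightedFourierNorm_eq_eLpNorm (by linarith) ht.le]
    refine (hC _ _ (hf.averageOp_sub hp1 μ t) (hfg.averageOp_sub hp1 hf μ t)).trans ?_
    rw [ENNReal.ofReal_mul (by positivity), mul_assoc]
    refine mul_le_mul' ?_ (eLpNorm_le_mul_eLpNorm_of_ae_le_mul
      (Filter.Eventually.of_forall fun ξ => ?_) _)
    · rw [← ENNReal.ofReal_coe_nnreal]
      exact ENNReal.ofReal_le_ofReal (by linarith)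
    · rw [norm_weighted_mul, norm_mul, hmin t ht, ← mul_assoc]
      exact mul_le_mul_of_nonneg_right (hnorm t ht ξ).2 (norm_nonneg _)
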